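/- For a finite group $G$, a cover of $G$ is a collection of proper subgroups whose union is $G$; it is irredundant if no proper subcollection is a cover. Let $\beta(G)$ denote the number of distinct irredundant covers of $G$. Write $\mathbb{Z}_r$ for the cyclic group of order $r$, $Q_8$ for the quaternion group of order $8$, and $\Phi(P)$ for the Frattini subgroup of $P$. Let $p$ be a prime, let $n\ge 1$ with $(p,n)=1$, and let $G=P\rtimes A$ be a finite group that is not nilpotent, where the normal factor $P$ is a $p$-group and $A\cong\mathbb{Z}_n$ is cyclic. Let $C_P(A)$ be the subgroup of elements of $P$ that commute with all elements of $A$. Assume that the subgroup $C_P(A)\times A$ of $G$ is cyclic and is a maximal subgroup of $G$, that $\{1\}\neq\Phi(P)\subseteq C_P(A)$, and that $C_P(A)$ is normal in $G$. Then $\beta(G)=2$ if and only if one of the following holds: (a) $P\cong \mathbb{Z}_{p^t}$ for some $t>1$, and $Z(G)\cong\mathbb{Z}_{p^{t-1}}\times\mathbb{Z}_{n/q^2}$ for some prime $q$ with $q^2\mid n$; (b) $G\cong (Q_8\rtimes\mathbb{Z}_{3^k})\times\mathbb{Z}_m$ for some integers $k\ge 0$ and $m\ge 1$ with $(m,6)=1$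 and some action of $\mathbb{Z}_{3^k}$ on $Q_8$. -/

import Mathlib

/-- A cover of a group: a collection of proper subgroups whose union is the whole group. -/
def IsSubgroupCover {G : Type*} [Group G] (S : Set (Subgroup G)) : Prop :=
  (∀ H ∈ S, H ≠ ⊤) ∧ (⋃ H ∈ S, (H : Set G)) = Set.univ

/-- A cover is irredundant if no proper subcollection of it is again a cover. -/
def IsIrredundantCover {G : Type*} [Group G] (S : Set (Subgroup G)) : Prop :=
  IsSubgroupCover S ∧ ∀ T : Set (Subgroup G), T ⊂ S → ¬ IsSubgroupCover T

/-- The number `β(G)` of distinct irredundant covers of a finite group `G`. -/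
noncomputable def irredundantCoverCount (G : Type*) [Group G] : ℕ :=
  {S : Set (Subgroup G) | IsIrredundantCover S}.ncard

/-- The Frattini subgroup of the subgroup `P`, viewed as a subgroup of `G`. -/
def frattiniIn {G : Type*} [Group G] (P : Subgroup G) : Subgroup G :=
  (frattini P).map P.subtype

/-- `C_P(A)`: the elements of `P` commuting with every element of `A`. -/
def centralizerIn {G : Type*} [Group G] (P A : Subgroup G) : Subgroup G :=
  P ⊓ Subgroup.centralizer (A : Set G)

/-! Write `C = C_P(A)`, `K = C_A(P)`, `M = CA`. Since `M` is abelian and maximal, the centralizer of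
any subset of `M` is `M` or `G`. As `M` is not normal while `C` is, `C` is central, and an element
of `A` outside `K` commutes with no element of `P` outside `C`. So `A/K` acts fixed-point-freely on
`P/C`, and every element outside `PK` is conjugate into `M` (`exists_conj_mem_sup`).

Because `M` is cyclic and maximal, every cover contains all conjugates of `M`. These miss exactly
the products `xk` with `x ∈ P \ C` and `k ∈ K`, so covers differ only in how they treat this set.
Each proper `R ≥ K` that meets `P \ C` yields an irredundant cover `coverWith P A R`. The choices `R
= PK` and `R = ⟨x⟩K` already give two, distinct because `P` is not cyclic (`ne_zpowers`).

If `β(G) = 2`, taking `R = TK` shows that every proper subgroup `T` of `P` not inside `C` is cyclic.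
This makes `P` nonabelian with `C = ⟨x^p⟩` for every `x ∈ P \ C`, and a class-two power computation
leaves only `p = 2` and `P ≅ Q₈`. The action on the six elements of `P \ C` then gives `|A : K| =
3`, and `G` splits as in (b). Conversely, for `P ≅ Q₈` an irredundant cover contains either the
maximal subgroup `PK` or all the `⟨x⟩K`. Alternative (a) never occurs, since it would make `P`
cyclic. -/

/-- `G = P ⋊ A` is a non-nilpotent finite group with `P` a `p`-group, `A` a cyclic `p'`-group,
`C_P(A) × A` cyclic and maximal, and `C_P(A)` normal and containing `Φ(P) ≠ 1`. -/
structure IsCyclicMaximalSplit {G : Type*} [Group G] (p : ℕ) (P A : Subgroup G) : Prop where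
  prime : p.Prime
  coprime : p.Coprime (Nat.card A)
  isPGroup : IsPGroup p P
  normal : P.Normal
  compl : P.IsComplement' A
  cyclic : IsCyclic A
  not_nilpotent : ¬ Group.IsNilpotent G
  cyclic_sup : IsCyclic ↥(centralizerIn P A ⊔ A)
  isCoatom : IsCoatom (centralizerIn P A ⊔ A)
  frattini_le : frattiniIn P ≤ centralizerIn P A
  frattini_ne : frattiniIn P ≠ ⊥
  normal_centralizer : (centralizerIn P A).Normal

/-! ### Powers, commutators and the Frattini subgroup of a finite `p`-group. -/

section PGroup

variable {G : Type*} [Group G]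

theorem mem_centralizerIn {P A : Subgroup G} {x : G} :
    x ∈ centralizerIn P A ↔ x ∈ P ∧ ∀ a ∈ A, a * x = x * a := by
  simp [centralizerIn, Subgroup.mem_centralizer_iff]

theorem IsPGroup.eq_one_of_mem_zpowers_pow {p : ℕ} (hp : p.Prime) (hG : IsPGroup p G) {x : G}
    (h : x ∈ Subgroup.zpowers (x ^ p)) : x = 1 := by
  have := Fact.mk hp
  by_contra hx
  have h1 := hG.dvd_orderOf hx
  obtain ⟨k, hk⟩ := h
  have h2 : x ^ ((p : ℤ) * k - 1) = 1 := by
    have : (x ^ p) ^ k = x := hk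
    rw [zpow_sub, zpow_mul, zpow_natCast, this]; simp
  have h3 := orderOf_dvd_iff_zpow_eq_one.2 h2
  have h4 : (p : ℤ) ∣ (p : ℤ) * k - 1 := (Int.natCast_dvd_natCast.2 h1).trans h3
  have h5 : (p : ℤ) ∣ 1 := by
    have := dvd_sub (dvd_mul_right (p : ℤ) k) h4
    simpa using this
  have := Int.natCast_dvd_natCast.1 (by simpa using h5 : (p : ℤ) ∣ ((1 : ℕ) : ℤ))
  exact hp.one_lt.ne' (Nat.dvd_one.1 this)

/-- An exponent is either divisible by `p` or invertible modulo the order of `x`. -/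
theorem IsPGroup.mem_zpowers_pow_or {p : ℕ} (hp : p.Prime) (hG : IsPGroup p G) {x y : G}
    (h : y ∈ Subgroup.zpowers x) :
    y ∈ Subgroup.zpowers (x ^ p) ∨ x ∈ Subgroup.zpowers y := by
  obtain ⟨k, rfl⟩ := h
  have := Fact.mk hp
  by_cases hk : (p : ℤ) ∣ k
  · left
    obtain ⟨j, rfl⟩ := hk
    exact ⟨j, by simp [zpow_mul]⟩
  · right
    obtain ⟨m, hm⟩ := IsPGroup.iff_orderOf.1 hG x
    have hc : IsCoprime k ((orderOf x : ℕ) : ℤ) := by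
      rw [hm]
      push_cast
      exact ((Nat.prime_iff_prime_int.1 hp).coprime_iff_not_dvd.2 hk).symm.pow_right
    obtain ⟨a, b, hab⟩ := hc
    refine ⟨a, ?_⟩
    change (x ^ k) ^ a = x
    have : k * a = 1 - (orderOf x : ℤ) * b := by linarith
    rw [← zpow_mul, this, zpow_sub, zpow_mul, zpow_natCast, pow_orderOf_eq_one]
    simp

/-- Nilpotency makes `M` normal, and maximality makes every nontrivial element of `G ⧸ M` a
generator; so the quotient is abelian of exponent `p`. -/
theorem IsPGroup.mul_comm_and_pow_mem_of_isCoatom [Finite G] {p : ℕ} (hp : p.Prime)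
    (hG : IsPGroup p G) {M : Subgroup G} (hM : IsCoatom M) :
    (∀ x y : G, x * y * x⁻¹ * y⁻¹ ∈ M) ∧ ∀ x : G, x ^ p ∈ M := by
  have := Fact.mk hp
  have := hG.isNilpotent
  have : M.Normal := Subgroup.NormalizerCondition.normal_of_coatom M Group.normalizerCondition_of_isNilpotent hM
  have key : ∀ x : G ⧸ M, x ≠ 1 → Subgroup.zpowers x = ⊤ := by
    intro x hx
    have h1 : M ≤ (Subgroup.zpowers x).comap (QuotientGroup.mk' M) := by
      intro m hm
      rw [Subgroup.mem_comap]
      have : QuotientGroup.mk' M m = 1 := (QuotientGroup.eq_one_iff m).2 hm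
      rw [this]; exact one_mem _
    have hs : Function.Surjective (QuotientGroup.mk' M) := QuotientGroup.mk'_surjective M
    rcases eq_or_lt_of_le h1 with h | h
    · exfalso
      obtain ⟨g, rfl⟩ := hs x
      have : g ∈ (Subgroup.zpowers (QuotientGroup.mk' M g)).comap (QuotientGroup.mk' M) :=
        Subgroup.mem_zpowers _
      rw [← h] at this
      exact hx ((QuotientGroup.eq_one_iff g).2 this)
    · have := hM.2 _ h
      rw [← Subgroup.map_comap_eq_self_of_surjective hs (Subgroup.zpowers x), this]
      exact Subgroup.map_top_of_surjective _ hs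
  constructor
  · intro x y
    rw [← QuotientGroup.eq_one_iff]
    change (x : G ⧸ M) * (y : G ⧸ M) * (x : G ⧸ M)⁻¹ * (y : G ⧸ M)⁻¹ = 1
    by_cases hx : (x : G ⧸ M) = 1
    · simp [hx]
    · have : (y : G ⧸ M) ∈ Subgroup.zpowers (x : G ⧸ M) := by rw [key _ hx]; trivial
      obtain ⟨k, hk⟩ := this
      rw [← hk]
      change (x : G ⧸ M) * (x : G ⧸ M) ^ k * (x : G ⧸ M)⁻¹ * ((x : G ⧸ M) ^ k)⁻¹ = 1
      group
  · intro x
    rw [← QuotientGroup.eq_one_iff]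
    change (x : G ⧸ M) ^ p = 1
    by_contra h
    have h1 : (x : G ⧸ M) ∈ Subgroup.zpowers ((x : G ⧸ M) ^ p) := by rw [key _ h]; trivial
    apply h
    rw [(hG.to_quotient M).eq_one_of_mem_zpowers_pow hp h1, one_pow]

theorem IsPGroup.commutator_mem_frattini [Finite G] {p : ℕ} (hp : p.Prime)
    (hG : IsPGroup p G) (x y : G) : x * y * x⁻¹ * y⁻¹ ∈ frattini G := by
  simp only [frattini, Order.radical, Subgroup.mem_iInf]
  exact fun M hM => (hG.mul_comm_and_pow_mem_of_isCoatom hp hM).1 x y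

theorem IsPGroup.pow_mem_frattini [Finite G] {p : ℕ} (hp : p.Prime)
    (hG : IsPGroup p G) (x : G) : x ^ p ∈ frattini G := by
  simp only [frattini, Order.radical, Subgroup.mem_iInf]
  exact fun M hM => (hG.mul_comm_and_pow_mem_of_isCoatom hp hM).2 x

end PGroup

/-! ### Coprime action of `A` on `P`: central subgroups and fixed points. -/

namespace IsCyclicMaximalSplit

variable {G : Type*} [Group G] {p : ℕ} {P A : Subgroup G}

theorem pow_mem [Finite G] (h : IsCyclicMaximalSplit p P A) {x : G} (hx : x ∈ P) :
    x ^ p ∈ centralizerIn P A :=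
  h.frattini_le ⟨_, h.isPGroup.pow_mem_frattini h.prime ⟨x, hx⟩, rfl⟩

theorem commutator_mem [Finite G] (h : IsCyclicMaximalSplit p P A) {x y : G} (hx : x ∈ P) (hy : y ∈ P) :
    x * y * x⁻¹ * y⁻¹ ∈ centralizerIn P A :=
  h.frattini_le ⟨_, h.isPGroup.commutator_mem_frattini h.prime ⟨x, hx⟩ ⟨y, hy⟩, rfl⟩

theorem eq_one_of_mem_of_mem (h : IsCyclicMaximalSplit p P A) {x : G} (hx : x ∈ P) (ha : x ∈ A) :
    x = 1 := Subgroup.disjoint_def.1 h.compl.disjoint hx ha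

theorem eq_one_of_mem_of_pow_card (h : IsCyclicMaximalSplit p P A) {x : G} (hx : x ∈ P)
    (ha : x ^ Nat.card A = 1) : x = 1 := by
  have h1 := h.isPGroup.orderOf_coprime h.coprime ⟨x, hx⟩
  rw [Subgroup.orderOf_mk] at h1
  exact orderOf_eq_one_iff.1 (Nat.Coprime.eq_one_of_dvd h1 (orderOf_dvd_of_pow_eq_one ha))

theorem pow_card_eq_one {b : G} (hb : b ∈ A) : b ^ Nat.card A = 1 := by
  exact congrArg Subtype.val (pow_card_eq_one' (x := (⟨b, hb⟩ : A)))

theorem mul_comm_of_mem (h : IsCyclicMaximalSplit p P A) {a b : G} (ha : a ∈ A) (hb : b ∈ A) :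
    a * b = b * a := by
  have := h.cyclic
  have := (IsCyclic.commGroup (α := A)).mul_comm ⟨a, ha⟩ ⟨b, hb⟩
  simpa [Subtype.ext_iff] using this

theorem exists_mul_eq (h : IsCyclicMaximalSplit p P A) (g : G) :
    ∃ x ∈ P, ∃ b ∈ A, x * b = g := by
  have := h.normal
  exact Subgroup.mem_sup_of_normal_left.1 (by rw [h.compl.sup_eq_top]; trivial)

theorem mem_iff_sup (h : IsCyclicMaximalSplit p P A) {m : G} :
    m ∈ centralizerIn P A ⊔ A ↔ ∃ c ∈ centralizerIn P A, ∃ a ∈ A, c * a = m := by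
  have := h.normal_centralizer
  exact Subgroup.mem_sup_of_normal_left

theorem mem_centralizerIn_of_mem (h : IsCyclicMaximalSplit p P A) {x : G} (hx : x ∈ P)
    (hm : x ∈ centralizerIn P A ⊔ A) : x ∈ centralizerIn P A := by
  obtain ⟨c, hc, a, ha, rfl⟩ := h.mem_iff_sup.1 hm
  have : a = 1 := h.eq_one_of_mem_of_mem ((Subgroup.mul_mem_cancel_left _ hc.1).1 hx) ha
  simpa [this] using hc

/-- If `c` is the commutator, `xbx⁻¹ = cb` with `c` and `b` commuting; raising to the power `|A|`
gives `c ^ |A| = 1`, so the `p`-element `c` is trivial. -/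
theorem commute_of_commutator_mem (h : IsCyclicMaximalSplit p P A) {x b : G}
    (hb : b ∈ A) (hc : x * b * x⁻¹ * b⁻¹ ∈ centralizerIn P A) : x * b = b * x := by
  set c := x * b * x⁻¹ * b⁻¹ with hcdef
  have h1 : x * b * x⁻¹ = c * b := by rw [hcdef]; group
  have hcomm : Commute c b := ((mem_centralizerIn.1 hc).2 b hb).symm
  have h2 : (c * b) ^ Nat.card A = 1 := by
    rw [← h1, conj_pow, pow_card_eq_one hb]; simp
  rw [hcomm.mul_pow, pow_card_eq_one hb, mul_one] at h2
  have h3 := h.eq_one_of_mem_of_pow_card hc.1 h2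
  rw [h3, one_mul] at h1
  exact mul_inv_eq_iff_eq_mul.1 h1

theorem not_le_centralizer [Finite G] (h : IsCyclicMaximalSplit p P A) :
    ¬ ∀ x ∈ P, ∀ a ∈ A, x * a = a * x := by
  intro hc
  apply h.not_nilpotent
  have := Fact.mk h.prime
  have := h.isPGroup.isNilpotent
  have := h.cyclic
  have : IsMulCommutative A := ⟨⟨(IsCyclic.commGroup (α := A)).mul_comm⟩⟩
  let : CommGroup A := IsCyclic.commGroup
  let f : P × A →* G := MonoidHom.noncommCoprod P.subtype A.subtype
    (fun x a => hc x x.2 a a.2)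
  have hf : Function.Surjective f := by
    intro g
    obtain ⟨x, hx, b, hb, rfl⟩ := h.exists_mul_eq g
    exact ⟨(⟨x, hx⟩, ⟨b, hb⟩), rfl⟩
  exact Group.nilpotent_of_surjective f hf

theorem commute_of_sup (h : IsCyclicMaximalSplit p P A) {a b : G}
    (ha : a ∈ centralizerIn P A ⊔ A) (hb : b ∈ centralizerIn P A ⊔ A) : a * b = b * a := by
  have := h.cyclic_sup
  have := (IsCyclic.commGroup (α := ↥(centralizerIn P A ⊔ A))).mul_comm ⟨a, ha⟩ ⟨b, hb⟩
  simpa [Subtype.ext_iff] using this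

theorem centralizer_eq_or (h : IsCyclicMaximalSplit p P A) {s : Set G}
    (hs : s ⊆ ((centralizerIn P A ⊔ A : Subgroup G) : Set G)) :
    Subgroup.centralizer s = centralizerIn P A ⊔ A ∨ Subgroup.centralizer s = ⊤ := by
  have : centralizerIn P A ⊔ A ≤ Subgroup.centralizer s := by
    intro m hm
    rw [Subgroup.mem_centralizer_iff]
    exact fun t ht => h.commute_of_sup (hs ht) hm
  exact (h.isCoatom.le_iff.1 this).symm

/-- Normality would put the commutators of `P` with `A` into `P ∩ M = C`, hence make them trivial.
-/
theorem sup_not_normal [Finite G] (h : IsCyclicMaximalSplit p P A) :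
    ¬ (centralizerIn P A ⊔ A).Normal := by
  intro hn
  apply h.not_le_centralizer
  intro x hx a ha
  apply h.commute_of_commutator_mem ha
  apply h.mem_centralizerIn_of_mem
  · have := h.normal.conj_mem _ (inv_mem hx) a
    have := mul_mem hx this
    simpa [mul_assoc] using this
  · have ha' : a ∈ centralizerIn P A ⊔ A := Subgroup.mem_sup_right ha
    exact mul_mem (hn.conj_mem _ ha' x) (inv_mem ha')

/-- The centralizer of the normal subgroup `C` is normal, so it cannot be `M`. -/
theorem centralizerIn_le_center [Finite G] (h : IsCyclicMaximalSplit p P A) :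
    centralizerIn P A ≤ Subgroup.center G := by
  have := h.normal_centralizer
  rcases h.centralizer_eq_or (s := centralizerIn P A) (le_sup_left (b := A)) with h1 | h1
  · exfalso
    apply h.sup_not_normal
    rw [← h1]; infer_instance
  · exact Subgroup.centralizer_eq_top_iff_subset.1 h1

theorem mul_comm_of_mem_centralizerIn [Finite G] (h : IsCyclicMaximalSplit p P A) {c : G}
    (hc : c ∈ centralizerIn P A) (g : G) : g * c = c * g :=
  Subgroup.mem_center_iff.1 (h.centralizerIn_le_center hc) g

/-- The centralizer of `b` is `M` or `G`. This is the fixed-point-freeness behind all later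
counting. -/
theorem mem_or_mem_of_commute (h : IsCyclicMaximalSplit p P A) {x b : G} (hx : x ∈ P)
    (hb : b ∈ A) (hxb : x * b = b * x) : x ∈ centralizerIn P A ∨ b ∈ centralizerIn A P := by
  rcases h.centralizer_eq_or (s := {b}) (by simpa using Subgroup.mem_sup_right hb) with h1 | h1
  · left
    apply h.mem_centralizerIn_of_mem hx
    rw [← h1, Subgroup.mem_centralizer_iff]
    simpa using hxb.symm
  · right
    rw [mem_centralizerIn]
    refine ⟨hb, fun y _ => ?_⟩
    have : y ∈ Subgroup.centralizer {b} := by rw [h1]; trivial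
    rw [Subgroup.mem_centralizer_iff] at this
    exact (this b rfl).symm

theorem centralizerIn_symm_le_center (h : IsCyclicMaximalSplit p P A) :
    centralizerIn A P ≤ Subgroup.center G := by
  intro k hk
  rw [mem_centralizerIn] at hk
  rw [Subgroup.mem_center_iff]
  intro g
  obtain ⟨x, hx, b, hb, rfl⟩ := h.exists_mul_eq g
  rw [mul_assoc, h.mul_comm_of_mem hb hk.1, ← mul_assoc, hk.2 x hx, mul_assoc]

theorem mul_comm_of_mem_centralizerIn_symm (h : IsCyclicMaximalSplit p P A) {k : G}
    (hk : k ∈ centralizerIn A P) (g : G) : g * k = k * g :=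
  Subgroup.mem_center_iff.1 (h.centralizerIn_symm_le_center hk) g

theorem exists_conj_mem_sup [Finite G] (h : IsCyclicMaximalSplit p P A) {x b : G} (hx : x ∈ P)
    (hb : b ∈ A) (hbK : b ∉ centralizerIn A P) :
    ∃ g, g⁻¹ * (x * b) * g ∈ centralizerIn P A ⊔ A := by
  have := h.normal_centralizer
  set π := QuotientGroup.mk' (centralizerIn P A) with hπ
  let S := P.map π
  have hSn : S.Normal := h.normal.map π (QuotientGroup.mk'_surjective _)
  -- The map `s ↦ [s, b]` on `P/C`: it is injective because `b` has no fixed points there, hence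
  -- surjective, so `x` is a commutator `[y, b]` modulo the central subgroup `C`.
  let F : S → S := fun s => ⟨s * π b * (s : _)⁻¹ * (π b)⁻¹, by
    have := mul_mem s.2 (hSn.conj_mem _ (inv_mem s.2) (π b))
    simpa [mul_assoc] using this⟩
  have hF : Function.Injective F := by
    rintro ⟨_, y, hy, rfl⟩ ⟨_, z, hz, rfl⟩ hyz
    have h1 : π y * π b * (π y)⁻¹ * (π b)⁻¹ = π z * π b * (π z)⁻¹ * (π b)⁻¹ :=
      congrArg Subtype.val hyz
    have h2 : π (z⁻¹ * y * b * (z⁻¹ * y)⁻¹ * b⁻¹) = 1 := by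
      have h1' : π y * π b * (π y)⁻¹ = π z * π b * (π z)⁻¹ := mul_right_cancel h1
      simp only [map_mul, map_inv, mul_inv_rev, inv_inv]
      calc (π z)⁻¹ * π y * π b * ((π y)⁻¹ * π z) * (π b)⁻¹
          = (π z)⁻¹ * (π y * π b * (π y)⁻¹) * π z * (π b)⁻¹ := by group
        _ = 1 := by rw [h1']; group
    have hw : z⁻¹ * y ∈ P := mul_mem (inv_mem hz) hy
    have h3 := h.commute_of_commutator_mem hb ((QuotientGroup.eq_one_iff _).1 h2)
    have h4 := (h.mem_or_mem_of_commute hw hb h3).resolve_right hbK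
    exact Subtype.ext (QuotientGroup.eq.2 h4).symm
  obtain ⟨⟨_, y, hy, rfl⟩, hs⟩ := Finite.surjective_of_injective hF ⟨π x, x, hx, rfl⟩
  have h1 : π (y * b * y⁻¹ * b⁻¹) = π x := by
    simp only [map_mul, map_inv]
    exact congrArg Subtype.val hs
  have h2 := QuotientGroup.eq.1 h1
  refine ⟨y, ?_⟩
  set c := (y * b * y⁻¹ * b⁻¹)⁻¹ * x with hc
  have h3 : y⁻¹ * (x * b) * y = c * b := by
    have h4 : x * b = y * b * y⁻¹ * c := by
      have : y * b * y⁻¹ * c = y * b * y⁻¹ * b⁻¹ * (b * c) := by group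
      rw [this, h.mul_comm_of_mem_centralizerIn h2 b, hc]; group
    rw [h4, ← h.mul_comm_of_mem_centralizerIn h2 b]
    calc y⁻¹ * (y * b * y⁻¹ * c) * y = b * y⁻¹ * (c * y) := by group
      _ = b * c := by rw [← h.mul_comm_of_mem_centralizerIn h2 y]; group
  rw [h3]
  exact mul_mem (Subgroup.mem_sup_left h2) (Subgroup.mem_sup_right hb)

end IsCyclicMaximalSplit

/-! ### Covers: the forced members and the family `coverWith`. -/

/-- The set of conjugates of a subgroup. -/
def conjugatesOfSubgroup {G : Type*} [Group G] (M : Subgroup G) : Set (Subgroup G) :=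
  Set.range fun g : G => M.map (MulAut.conj g).toMonoidHom

theorem mem_map_conj {G : Type*} [Group G] {M : Subgroup G} {g z : G} :
    z ∈ M.map (MulAut.conj g).toMonoidHom ↔ g⁻¹ * z * g ∈ M := by
  constructor
  · rintro ⟨m, hm, rfl⟩
    simpa [mul_assoc] using hm
  · intro h
    exact ⟨_, h, by simp [mul_assoc]⟩

theorem IsSubgroupCover.exists_mem {G : Type*} [Group G] {S : Set (Subgroup G)}
    (hS : IsSubgroupCover S) (g : G) : ∃ H ∈ S, g ∈ H := by
  have : g ∈ ⋃ H ∈ S, (H : Set G) := by rw [hS.2]; trivial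
  simpa using this

theorem isSubgroupCover_iff {G : Type*} [Group G] {S : Set (Subgroup G)} :
    IsSubgroupCover S ↔ (∀ H ∈ S, H ≠ ⊤) ∧ ∀ g : G, ∃ H ∈ S, g ∈ H :=
  ⟨fun h => ⟨h.1, h.exists_mem⟩, fun h => ⟨h.1, by ext g; simpa using h.2 g⟩⟩

theorem IsIrredundantCover.eq_of_subset {G : Type*} [Group G] {S T : Set (Subgroup G)}
    (hS : IsIrredundantCover S) (hT : IsSubgroupCover T) (h : T ⊆ S) : T = S := by
  by_contra hne
  exact hS.2 T (h.ssubset_of_ne hne) hT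

/-- The irredundant cover by the conjugates of `C_P(A) ⊔ A`, the subgroup `R`, and the subgroups
`⟨x⟩ ⊔ C_A(P)` for `x ∈ P` outside `C_P(A)` and `R`. -/
def coverWith {G : Type*} [Group G] (P A R : Subgroup G) : Set (Subgroup G) :=
  conjugatesOfSubgroup (centralizerIn P A ⊔ A) ∪ {R} ∪
    {H | ∃ x ∈ P, x ∉ centralizerIn P A ∧ x ∉ R ∧ H = Subgroup.zpowers x ⊔ centralizerIn A P}

namespace IsCyclicMaximalSplit

variable {G : Type*} [Group G] {p : ℕ} {P A : Subgroup G}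

theorem exists_notMem [Finite G] (h : IsCyclicMaximalSplit p P A) :
    ∃ x ∈ P, x ∉ centralizerIn P A := by
  by_contra! hc
  exact h.not_le_centralizer fun x hx a ha => ((mem_centralizerIn.1 (hc x hx)).2 a ha).symm

theorem exists_notMem_symm [Finite G] (h : IsCyclicMaximalSplit p P A) :
    ∃ b ∈ A, b ∉ centralizerIn A P := by
  by_contra! hc
  exact h.not_le_centralizer fun x hx a ha => (mem_centralizerIn.1 (hc a ha)).2 x hx

theorem normal_centralizerIn_symm (h : IsCyclicMaximalSplit p P A) :
    (centralizerIn A P).Normal :=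
  ⟨fun k hk g => by rw [h.mul_comm_of_mem_centralizerIn_symm hk]; simpa using hk⟩

theorem mem_sup_symm_iff (h : IsCyclicMaximalSplit p P A) {T : Subgroup G} {z : G} :
    z ∈ T ⊔ centralizerIn A P ↔ ∃ t ∈ T, ∃ k ∈ centralizerIn A P, t * k = z := by
  have := h.normal_centralizerIn_symm
  exact Subgroup.mem_sup_of_normal_right

theorem mem_sup_symm_iff_of_le (h : IsCyclicMaximalSplit p P A) {T : Subgroup G} (hT : T ≤ P)
    {y : G} (hy : y ∈ P) : y ∈ T ⊔ centralizerIn A P ↔ y ∈ T := by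
  refine ⟨fun hz => ?_, fun hz => Subgroup.mem_sup_left hz⟩
  obtain ⟨t, ht, k, hk, rfl⟩ := h.mem_sup_symm_iff.1 hz
  have : k = 1 := h.eq_one_of_mem_of_mem ((Subgroup.mul_mem_cancel_left _ (hT ht)).1 hy) hk.1
  simpa [this] using ht

theorem isCoatom_map_conj (h : IsCyclicMaximalSplit p P A) (g : G) :
    IsCoatom ((centralizerIn P A ⊔ A).map (MulAut.conj g).toMonoidHom) :=
  ((MulAut.conj g).mapSubgroup.isCoatom_iff _).2 h.isCoatom

/-- A member containing a generator of a conjugate of `M` contains that maximal subgroup, hence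
equals it. -/
theorem conjugates_subset (h : IsCyclicMaximalSplit p P A) {S : Set (Subgroup G)}
    (hS : IsSubgroupCover S) : conjugatesOfSubgroup (centralizerIn P A ⊔ A) ⊆ S := by
  rintro _ ⟨g, rfl⟩
  obtain ⟨⟨m, hm⟩, hgen⟩ := h.cyclic_sup.exists_generator
  obtain ⟨H, hH, hmH⟩ := hS.exists_mem (g * m * g⁻¹)
  have hle : (centralizerIn P A ⊔ A).map (MulAut.conj g).toMonoidHom ≤ H := by
    rintro _ ⟨y, hy, rfl⟩
    obtain ⟨k, hk⟩ := hgen ⟨y, hy⟩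
    have hk' : m ^ k = y := congrArg Subtype.val hk
    have : (MulAut.conj g).toMonoidHom y = (g * m * g⁻¹) ^ k := by
      rw [conj_zpow, hk']; rfl
    rw [this]
    exact zpow_mem hmH k
  rcases (h.isCoatom_map_conj g).le_iff.1 hle with h1 | h1
  · exact absurd h1 (hS.1 H hH)
  · rw [h1] at hH
    exact hH

theorem notMem_of_mem_conjugates [Finite G] (h : IsCyclicMaximalSplit p P A) {x k : G}
    (hx : x ∈ P) (hxC : x ∉ centralizerIn P A) (hk : k ∈ centralizerIn A P) {H : Subgroup G}
    (hH : H ∈ conjugatesOfSubgroup (centralizerIn P A ⊔ A)) : x * k ∉ H := by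
  obtain ⟨g, rfl⟩ := hH
  intro hmem
  rw [mem_map_conj] at hmem
  have h1 : g⁻¹ * (x * k) * g = g⁻¹ * x * g * k := by
    rw [mul_assoc, mul_assoc x, ← h.mul_comm_of_mem_centralizerIn_symm hk]; group
  rw [h1, Subgroup.mul_mem_cancel_right _ (Subgroup.mem_sup_right hk.1)] at hmem
  have h2 : g⁻¹ * x * g ∈ P := by simpa using h.normal.conj_mem x hx g⁻¹
  have h3 := h.normal_centralizer.conj_mem _ (h.mem_centralizerIn_of_mem h2 hmem) g
  exact hxC (by simpa [mul_assoc] using h3)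

theorem exists_mem_conjugates_or [Finite G] (h : IsCyclicMaximalSplit p P A) (z : G) :
    (∃ H ∈ conjugatesOfSubgroup (centralizerIn P A ⊔ A), z ∈ H) ∨
      ∃ x ∈ P, x ∉ centralizerIn P A ∧ ∃ k ∈ centralizerIn A P, x * k = z := by
  obtain ⟨x, hx, b, hb, rfl⟩ := h.exists_mul_eq z
  by_cases hbK : b ∈ centralizerIn A P
  · by_cases hxC : x ∈ centralizerIn P A
    · refine Or.inl ⟨_, ⟨1, rfl⟩, mem_map_conj.2 ?_⟩
      simpa using mul_mem (Subgroup.mem_sup_left hxC) (Subgroup.mem_sup_right hb)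
    · exact Or.inr ⟨x, hx, hxC, b, hbK, rfl⟩
  · obtain ⟨g, hg⟩ := h.exists_conj_mem_sup hx hb hbK
    exact Or.inl ⟨_, ⟨g, rfl⟩, mem_map_conj.2 hg⟩

theorem mem_zpowers_pow_or (h : IsCyclicMaximalSplit p P A) {x y : G} (hx : x ∈ P)
    (hyx : y ∈ Subgroup.zpowers x) : y ∈ Subgroup.zpowers (x ^ p) ∨ x ∈ Subgroup.zpowers y := by
  have hyP : y ∈ P := (Subgroup.zpowers_le.2 hx) hyx
  have h1 : (⟨y, hyP⟩ : P) ∈ Subgroup.zpowers (⟨x, hx⟩ : P) := by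
    obtain ⟨k, rfl⟩ := hyx
    exact ⟨k, rfl⟩
  rcases h.isPGroup.mem_zpowers_pow_or h.prime h1 with ⟨k, hk⟩ | ⟨k, hk⟩
  · exact Or.inl ⟨k, congrArg Subtype.val hk⟩
  · exact Or.inr ⟨k, congrArg Subtype.val hk⟩

/-- Since `x ^ p ∈ C`, every proper subgroup of `⟨x⟩` lies in `C`; so distinct cyclic subgroups of
`P` meet inside `C` once neither lies in `C`. -/
theorem mem_zpowers_symm [Finite G] (h : IsCyclicMaximalSplit p P A) {x y : G} (hx : x ∈ P)
    (hyC : y ∉ centralizerIn P A) (hyx : y ∈ Subgroup.zpowers x) : x ∈ Subgroup.zpowers y :=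
  (h.mem_zpowers_pow_or hx hyx).resolve_left fun hy =>
    hyC ((Subgroup.zpowers_le.2 (h.pow_mem hx)) hy)

theorem sup_symm_ne_top [Finite G] (h : IsCyclicMaximalSplit p P A) {T : Subgroup G}
    (hT : T ≤ P) : T ⊔ centralizerIn A P ≠ ⊤ := by
  intro htop
  obtain ⟨b, hb, hbK⟩ := h.exists_notMem_symm
  obtain ⟨t, ht, k, hk, rfl⟩ := h.mem_sup_symm_iff.1 (htop ▸ Subgroup.mem_top b)
  have : t = 1 := h.eq_one_of_mem_of_mem (hT ht) ((Subgroup.mul_mem_cancel_right _ hk.1).1 hb)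
  exact hbK (by simpa [this] using hk)

theorem isIrredundantCover_coverWith [Finite G] (h : IsCyclicMaximalSplit p P A) {R : Subgroup G}
    (hR : R ≠ ⊤) (hKR : centralizerIn A P ≤ R) {x₀ : G} (hx₀ : x₀ ∈ P)
    (hx₀C : x₀ ∉ centralizerIn P A) (hx₀R : x₀ ∈ R) : IsIrredundantCover (coverWith P A R) := by
  constructor
  · rw [isSubgroupCover_iff]
    constructor
    · rintro H ((⟨g, rfl⟩ | rfl) | ⟨x, hx, -, -, rfl⟩)
      · exact (h.isCoatom_map_conj g).1
      · exact hR
      · exact h.sup_symm_ne_top (Subgroup.zpowers_le.2 hx)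
    · intro z
      rcases h.exists_mem_conjugates_or z with ⟨H, hH, hz⟩ | ⟨x, hx, hxC, k, hk, rfl⟩
      · exact ⟨H, Or.inl (Or.inl hH), hz⟩
      · by_cases hxR : x ∈ R
        · exact ⟨R, Or.inl (Or.inr rfl), mul_mem hxR (hKR hk)⟩
        · exact ⟨_, Or.inr ⟨x, hx, hxC, hxR, rfl⟩, mul_mem
            (Subgroup.mem_sup_left (Subgroup.mem_zpowers x)) (Subgroup.mem_sup_right hk)⟩
  · intro T hT hcov
    obtain ⟨hTs, H, hH, hHT⟩ := Set.ssubset_iff_exists.1 hT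
    have hconj := h.conjugates_subset hcov
    -- In a subcover, `x ∈ P \ C` can only be covered by `R` or by the member built from `⟨x⟩`
    -- itself.
    have hcover : ∀ x ∈ P, x ∉ centralizerIn P A → (R ∈ T ∧ x ∈ R) ∨
        ∃ y ∈ P, y ∉ R ∧ Subgroup.zpowers y ⊔ centralizerIn A P ∈ T ∧
          x ∈ Subgroup.zpowers y ∧ y ∈ Subgroup.zpowers x := by
      intro x hx hxC
      obtain ⟨H', hH', hxH'⟩ := hcov.exists_mem x
      rcases hTs hH' with (hc | rfl) | ⟨y, hy, -, hyR, rfl⟩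
      · exact absurd (by simpa using hxH') (h.notMem_of_mem_conjugates hx hxC (one_mem _) hc)
      · exact Or.inl ⟨hH', hxH'⟩
      · have h1 := (h.mem_sup_symm_iff_of_le (Subgroup.zpowers_le.2 hy) hx).1 hxH'
        exact Or.inr ⟨y, hy, hyR, hH', h1, h.mem_zpowers_symm hy hxC h1⟩
    rcases hH with (hc | rfl) | ⟨x, hx, hxC, hxR, rfl⟩
    · exact hHT (hconj hc)
    · rcases hcover x₀ hx₀ hx₀C with h1 | ⟨y, -, hyR, -, -, hyx⟩
      · exact hHT h1.1
      · exact hyR ((Subgroup.zpowers_le.2 hx₀R) hyx)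
    · rcases hcover x hx hxC with h1 | ⟨y, -, -, hyT, hxy, hyx⟩
      · exact hxR h1.2
      · have : Subgroup.zpowers y = Subgroup.zpowers x :=
          le_antisymm (Subgroup.zpowers_le.2 hyx) (Subgroup.zpowers_le.2 hxy)
        rw [this] at hyT
        exact hHT hyT

theorem notMem_conjugates [Finite G] (h : IsCyclicMaximalSplit p P A) {R : Subgroup G}
    {x : G} (hx : x ∈ P) (hxC : x ∉ centralizerIn P A) (hxR : x ∈ R) :
    R ∉ conjugatesOfSubgroup (centralizerIn P A ⊔ A) :=
  fun hR => h.notMem_of_mem_conjugates hx hxC (one_mem _) hR (by simpa using hxR)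

theorem coverWith_sup (P A : Subgroup G) :
    coverWith P A (P ⊔ centralizerIn A P) =
      conjugatesOfSubgroup (centralizerIn P A ⊔ A) ∪ {P ⊔ centralizerIn A P} := by
  apply Set.union_eq_left.2
  rintro _ ⟨x, hx, -, hxR, -⟩
  exact absurd (Subgroup.mem_sup_left hx) hxR

/-- The cover does not depend on the choice of `x`. -/
theorem coverWith_zpowers [Finite G] (h : IsCyclicMaximalSplit p P A) {x : G} (hx : x ∈ P)
    (hxC : x ∉ centralizerIn P A) :
    coverWith P A (Subgroup.zpowers x ⊔ centralizerIn A P) =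
      conjugatesOfSubgroup (centralizerIn P A ⊔ A) ∪
        {H | ∃ y ∈ P, y ∉ centralizerIn P A ∧ H = Subgroup.zpowers y ⊔ centralizerIn A P} := by
  ext H
  constructor
  · rintro ((hc | rfl) | ⟨y, hy, hyC, -, rfl⟩)
    · exact Or.inl hc
    · exact Or.inr ⟨x, hx, hxC, rfl⟩
    · exact Or.inr ⟨y, hy, hyC, rfl⟩
  · rintro (hc | ⟨y, hy, hyC, rfl⟩)
    · exact Or.inl (Or.inl hc)
    · by_cases hyx : y ∈ Subgroup.zpowers x ⊔ centralizerIn A P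
      · have h1 := (h.mem_sup_symm_iff_of_le (Subgroup.zpowers_le.2 hx) hy).1 hyx
        have : Subgroup.zpowers y = Subgroup.zpowers x :=
          le_antisymm (Subgroup.zpowers_le.2 h1)
            (Subgroup.zpowers_le.2 (h.mem_zpowers_symm hx hyC h1))
        exact Or.inl (Or.inr (by rw [this]; rfl))
      · exact Or.inr ⟨y, hy, hyC, hyx, rfl⟩

theorem eq_of_sup_symm_eq (h : IsCyclicMaximalSplit p P A) {T₁ T₂ : Subgroup G} (h₁ : T₁ ≤ P)
    (h₂ : T₂ ≤ P) (heq : T₁ ⊔ centralizerIn A P = T₂ ⊔ centralizerIn A P) : T₁ = T₂ := by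
  ext y
  constructor
  · intro hy
    rw [← h.mem_sup_symm_iff_of_le h₂ (h₁ hy), ← heq]
    exact Subgroup.mem_sup_left hy
  · intro hy
    rw [← h.mem_sup_symm_iff_of_le h₁ (h₂ hy), heq]
    exact Subgroup.mem_sup_left hy

theorem isIrredundantCover_coverWith_sup [Finite G] (h : IsCyclicMaximalSplit p P A)
    {T : Subgroup G} (hT : T ≤ P) {x : G} (hx : x ∈ T) (hxC : x ∉ centralizerIn P A) :
    IsIrredundantCover (coverWith P A (T ⊔ centralizerIn A P)) :=
  h.isIrredundantCover_coverWith (h.sup_symm_ne_top hT) le_sup_right (hT hx) hxC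
    (Subgroup.mem_sup_left hx)

theorem mem_coverWith_self (P A R : Subgroup G) : R ∈ coverWith P A R := Or.inl (Or.inr rfl)

theorem eq_zpowers_of_coverWith_eq [Finite G] (h : IsCyclicMaximalSplit p P A) {T : Subgroup G}
    (hT : T ≤ P) {x : G} (hx : x ∈ T) (hxC : x ∉ centralizerIn P A)
    (heq : coverWith P A (T ⊔ centralizerIn A P) =
      coverWith P A (Subgroup.zpowers x ⊔ centralizerIn A P)) : ∃ y, T = Subgroup.zpowers y := by
  have h1 := mem_coverWith_self P A (T ⊔ centralizerIn A P)
  rw [heq, h.coverWith_zpowers (hT hx) hxC] at h1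
  rcases h1 with hc | ⟨y, hy, -, hyT⟩
  · exact absurd hc (h.notMem_conjugates (hT hx) hxC (Subgroup.mem_sup_left hx))
  · exact ⟨y, h.eq_of_sup_symm_eq hT (Subgroup.zpowers_le.2 hy) hyT⟩

/-- The covers for `R = PK`, `⟨x⟩K` and `TK` cannot be pairwise distinct, and the only possible
coincidence is between the last two. -/
theorem zpowers_of_irredundantCoverCount_eq_two [Finite G] (h : IsCyclicMaximalSplit p P A)
    (hP : ¬ ∃ x, P = Subgroup.zpowers x) (hβ : irredundantCoverCount G = 2) {T : Subgroup G}
    (hT : T ≤ P) (hTP : T ≠ P) {x : G} (hx : x ∈ T) (hxC : x ∉ centralizerIn P A) :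
    ∃ y, T = Subgroup.zpowers y := by
  have c1 := h.isIrredundantCover_coverWith_sup le_rfl (hT hx) hxC
  have c2 := h.isIrredundantCover_coverWith_sup (Subgroup.zpowers_le.2 (hT hx))
    (Subgroup.mem_zpowers x) hxC
  have c3 := h.isIrredundantCover_coverWith_sup hT hx hxC
  have n12 := fun heq => hP (h.eq_zpowers_of_coverWith_eq le_rfl (hT hx) hxC heq)
  have n13 : coverWith P A (T ⊔ centralizerIn A P) ≠ coverWith P A (P ⊔ centralizerIn A P) := by
    intro heq
    have h1 := mem_coverWith_self P A (T ⊔ centralizerIn A P)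
    rw [heq, coverWith_sup] at h1
    rcases h1 with hc | hc
    · exact h.notMem_conjugates (hT hx) hxC (Subgroup.mem_sup_left hx) hc
    · exact hTP (h.eq_of_sup_symm_eq hT le_rfl hc)
  by_contra hne
  have n23 := fun heq => hne (h.eq_zpowers_of_coverWith_eq hT hx hxC heq)
  obtain ⟨a, b, -, hab⟩ := Set.ncard_eq_two.1 hβ
  have hmem : ∀ S, IsIrredundantCover S → S = a ∨ S = b := fun S hS => by
    have : S ∈ {S : Set (Subgroup G) | IsIrredundantCover S} := hS
    rwa [hab] at this
  have := hmem _ c1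
  have := hmem _ c2
  have := hmem _ c3
  grind

end IsCyclicMaximalSplit

/-! ### Maps out of quaternion groups. -/

section Quaternion

variable {H : Type*} [Group H]

theorem zpow_intCast_zmod_cast {m : ℕ} {u : H} (hu : u ^ m = 1) (k : ℤ) :
    u ^ ((k : ZMod m).cast : ℤ) = u ^ k := by
  rw [ZMod.coe_intCast, Int.emod_def, zpow_sub, zpow_mul, zpow_natCast, hu]
  simp

theorem zpow_mul_eq_mul_zpow_neg {u y : H} (h : u * y = y * u⁻¹) (k : ℤ) :
    u ^ k * y = y * u ^ (-k) := by
  have : SemiconjBy y u⁻¹ u := h.symm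
  simpa using (this.zpow_right k).symm

/-- The homomorphism from a quaternion group given by elements satisfying its relations. -/
def QuaternionGroup.liftOfRelations {n : ℕ} (u y : H) (hu : u ^ (2 * n) = 1) (hy : y ^ 2 = u ^ n)
    (huy : u * y = y * u⁻¹) : QuaternionGroup n →* H :=
  MonoidHom.mk' (fun g => match g with
    | .a i => u ^ (i.cast : ℤ)
    | .xa i => y * u ^ (i.cast : ℤ)) (by
      rintro (i | i) (j | j) <;> obtain ⟨i, rfl⟩ := ZMod.intCast_surjective i <;>
        obtain ⟨j, rfl⟩ := ZMod.intCast_surjective j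
      · rw [QuaternionGroup.a_mul_a, ← Int.cast_add]
        simp only [zpow_intCast_zmod_cast hu, zpow_add]
      · rw [QuaternionGroup.a_mul_xa, ← Int.cast_sub]
        simp only [zpow_intCast_zmod_cast hu]
        rw [← mul_assoc, zpow_mul_eq_mul_zpow_neg huy, mul_assoc, ← zpow_add, neg_add_eq_sub]
      · rw [QuaternionGroup.xa_mul_a, ← Int.cast_add]
        simp only [zpow_intCast_zmod_cast hu, zpow_add, mul_assoc]
      · rw [QuaternionGroup.xa_mul_xa, ← Int.cast_natCast n, ← Int.cast_add, ← Int.cast_sub]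
        simp only [zpow_intCast_zmod_cast hu]
        rw [mul_assoc, ← mul_assoc _ y, zpow_mul_eq_mul_zpow_neg huy, mul_assoc y, ← mul_assoc y y,
          ← sq, hy, ← zpow_natCast, ← zpow_add, ← zpow_add]
        congr 1; ring)

theorem QuaternionGroup.liftOfRelations_a {n : ℕ} {u y : H} (hu : u ^ (2 * n) = 1)
    (hy : y ^ 2 = u ^ n) (huy : u * y = y * u⁻¹) (k : ℤ) :
    QuaternionGroup.liftOfRelations u y hu hy huy (.a k) = u ^ k :=
  zpow_intCast_zmod_cast hu k

theorem QuaternionGroup.liftOfRelations_xa {n : ℕ} {u y : H} (hu : u ^ (2 * n) = 1)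
    (hy : y ^ 2 = u ^ n) (huy : u * y = y * u⁻¹) (k : ℤ) :
    QuaternionGroup.liftOfRelations u y hu hy huy (.xa k) = y * u ^ k :=
  congrArg (y * ·) (zpow_intCast_zmod_cast hu k)

end Quaternion

/-! ### Powers of a product whose commutator is central. -/

section MulPow

variable {H : Type*} [Group H] {u y d : H}

theorem pow_mul_eq_of_mul_eq_mul_mul (hd : ∀ g, g * d = d * g) (h : y * u = u * y * d) (m : ℕ) :
    y ^ m * u = u * y ^ m * d ^ m := by
  have hdm : ∀ g, d ^ m * g = g * d ^ m := fun g => ((show Commute g d from hd g).pow_right m).symm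
  have h1 : SemiconjBy u (y * d) y := by
    rw [SemiconjBy, ← mul_assoc, h]
  have h2 := h1.pow_right m
  rw [(show Commute y d from hd y).mul_pow] at h2
  rw [← h2, mul_assoc]

/-- Moving `u` left past `y ^ i` costs `d ^ i`, and `0 + 1 + ⋯ + (m - 1) = m.choose 2`. -/
theorem mul_pow_of_mul_eq_mul_mul (hd : ∀ g, g * d = d * g) (h : y * u = u * y * d) (m : ℕ) :
    (u * y) ^ m = u ^ m * y ^ m * d ^ m.choose 2 := by
  induction m with
  | zero => simp
  | succ m ih =>
    have hdm : ∀ k : ℕ, ∀ g, d ^ k * g = g * d ^ k :=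
      fun k g => ((show Commute g d from hd g).pow_right k).symm
    rw [pow_succ, ih, mul_assoc _ _ (u * y), hdm, Nat.choose_succ_succ', Nat.choose_one_right,
      pow_add d]
    calc u ^ m * y ^ m * (u * y * d ^ m.choose 2)
        = u ^ m * (y ^ m * u) * y * d ^ m.choose 2 := by group
      _ = u ^ m * u * y ^ m * (d ^ m * y) * d ^ m.choose 2 := by
        rw [pow_mul_eq_of_mul_eq_mul_mul hd h]; simp only [mul_assoc]
      _ = u ^ (m + 1) * y ^ (m + 1) * (d ^ m * d ^ m.choose 2) := by
        rw [hdm, pow_succ, pow_succ]; simp only [mul_assoc]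

end MulPow

/-! ### Two covers force `P ≅ Q₈`. -/

namespace IsCyclicMaximalSplit

variable {G : Type*} [Group G] {p : ℕ} {P A : Subgroup G}

/-- The witness is a commutator `[y, b]`: its `p`-th power is `y ^ p` times the conjugate by `b` of
its inverse, and `y ^ p` is central. -/
theorem exists_pow_eq_one_of_commute [Finite G] (h : IsCyclicMaximalSplit p P A)
    (hcomm : ∀ x ∈ P, ∀ y ∈ P, x * y = y * x) : ∃ x ∈ P, x ∉ centralizerIn P A ∧ x ^ p = 1 := by
  obtain ⟨y, hy, hyC⟩ := h.exists_notMem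
  obtain ⟨b, hb, hbK⟩ := h.exists_notMem_symm
  have hb' : b * y⁻¹ * b⁻¹ ∈ P := h.normal.conj_mem _ (inv_mem hy) b
  refine ⟨y * (b * y⁻¹ * b⁻¹), mul_mem hy hb', fun hC => ?_, ?_⟩
  · have h1 := h.commute_of_commutator_mem (x := y) hb (by simpa [mul_assoc] using hC)
    exact (h.mem_or_mem_of_commute hy hb h1).elim hyC hbK
  · rw [(show Commute y (b * y⁻¹ * b⁻¹) from hcomm y hy _ hb').mul_pow, conj_pow, inv_pow,
      h.mul_comm_of_mem_centralizerIn (inv_mem (h.pow_mem hy)) b]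
    group

theorem not_frattiniIn_le_zpowers (h : IsCyclicMaximalSplit p P A) {x : G} (hx : x ∈ P)
    (hxC : x ∉ centralizerIn P A) (hxp : x ^ p = 1) : ¬ frattiniIn P ≤ Subgroup.zpowers x := by
  intro hle
  apply h.frattini_ne
  rw [eq_bot_iff]
  intro c hc
  rcases h.mem_zpowers_pow_or hx (hle hc) with h1 | h1
  · simpa [hxp] using h1
  · exact absurd ((Subgroup.zpowers_le.2 (h.frattini_le hc)) h1) hxC

/-- In a cyclic `P`, an element of order `p` outside `C` would generate `P`, contradicting `Φ(P) ≠
1`. -/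
theorem ne_zpowers [Finite G] (h : IsCyclicMaximalSplit p P A) : ¬ ∃ g, P = Subgroup.zpowers g := by
  rintro ⟨g, hg⟩
  have hgP : g ∈ P := hg ▸ Subgroup.mem_zpowers g
  obtain ⟨x, hx, hxC, hxp⟩ := h.exists_pow_eq_one_of_commute (by
    rw [hg]
    rintro _ ⟨i, rfl⟩ _ ⟨j, rfl⟩
    exact (Commute.refl g).zpow_zpow i j)
  apply h.not_frattiniIn_le_zpowers hx hxC hxp
  have h1 : g ∈ Subgroup.zpowers x := h.mem_zpowers_symm hgP hxC (hg ▸ hx)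
  exact (h.frattini_le.trans inf_le_left).trans (hg.le.trans (Subgroup.zpowers_le.2 h1))

theorem eq_of_sup_frattiniIn [Finite G] {T : Subgroup G} (hT : T ≤ P) (hTP : T ⊔ frattiniIn P = P) :
    T = P := by
  have h1 : T.subgroupOf P ⊔ frattini P = ⊤ := by
    apply Subgroup.map_injective P.subtype_injective
    rw [Subgroup.map_sup, Subgroup.map_subgroupOf_eq_of_le hT, ← MonoidHom.range_eq_map,
      Subgroup.range_subtype]
    exact hTP
  exact le_antisymm hT (Subgroup.subgroupOf_eq_top.1 (frattini_nongenerating h1))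

/-- For abelian `P` take `x ∉ C` of order `p`: the proper subgroup `⟨x⟩Φ(P)` is cyclic, hence equal
to `⟨x⟩`, which meets `Φ(P) ≤ C` trivially. -/
theorem exists_not_commute [Finite G] (h : IsCyclicMaximalSplit p P A)
    (hcyc : ∀ T ≤ P, T ≠ P → ∀ x ∈ T, x ∉ centralizerIn P A → ∃ g, T = Subgroup.zpowers g) :
    ∃ u ∈ P, ∃ y ∈ P, u * y ≠ y * u := by
  by_contra! hcomm
  obtain ⟨x, hx, hxC, hxp⟩ := h.exists_pow_eq_one_of_commute hcomm
  apply h.not_frattiniIn_le_zpowers hx hxC hxp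
  have hxP : Subgroup.zpowers x ≤ P := Subgroup.zpowers_le.2 hx
  have hxT : x ∈ Subgroup.zpowers x ⊔ frattiniIn P :=
    Subgroup.mem_sup_left (Subgroup.mem_zpowers x)
  have hT : Subgroup.zpowers x ⊔ frattiniIn P ≤ P :=
    sup_le hxP (h.frattini_le.trans inf_le_left)
  obtain ⟨g, hg⟩ := hcyc _ hT (fun heq => h.ne_zpowers ⟨x, (eq_of_sup_frattiniIn hxP heq).symm⟩)
    x hxT hxC
  have hgP : g ∈ P := hT (hg ▸ Subgroup.mem_zpowers g)
  exact le_sup_right.trans (hg.le.trans (Subgroup.zpowers_le.2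
    (h.mem_zpowers_symm hgP hxC (hg ▸ hxT))))

/-- `⟨x⟩C` is abelian, hence proper, hence cyclic and equal to `⟨x⟩`. -/
theorem centralizerIn_eq_zpowers_pow [Finite G] (h : IsCyclicMaximalSplit p P A)
    (hcyc : ∀ T ≤ P, T ≠ P → ∀ x ∈ T, x ∉ centralizerIn P A → ∃ g, T = Subgroup.zpowers g)
    {x : G} (hx : x ∈ P) (hxC : x ∉ centralizerIn P A) :
    centralizerIn P A = Subgroup.zpowers (x ^ p) := by
  refine le_antisymm (fun c hc => ?_) (Subgroup.zpowers_le.2 (h.pow_mem hx))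
  have := h.normal_centralizer
  have hT : Subgroup.zpowers x ⊔ centralizerIn P A ≤ P :=
    sup_le (Subgroup.zpowers_le.2 hx) inf_le_left
  have hxT : x ∈ Subgroup.zpowers x ⊔ centralizerIn P A :=
    Subgroup.mem_sup_left (Subgroup.mem_zpowers x)
  obtain ⟨g, hg⟩ := hcyc _ hT (by
    intro heq
    obtain ⟨u, hu, y, hy, huy⟩ := h.exists_not_commute hcyc
    apply huy
    rw [← heq] at hu hy
    obtain ⟨_, ⟨i, rfl⟩, c, hc, rfl⟩ := Subgroup.mem_sup_of_normal_right.1 hu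
    obtain ⟨_, ⟨j, rfl⟩, d, hd, rfl⟩ := Subgroup.mem_sup_of_normal_right.1 hy
    have hcc : ∀ g, Commute g c := h.mul_comm_of_mem_centralizerIn hc
    have hdc : ∀ g, Commute g d := h.mul_comm_of_mem_centralizerIn hd
    exact (((Commute.refl x).zpow_zpow i j).mul_right (hdc _)).mul_left (hcc _).symm) x hxT hxC
  have hgP : g ∈ P := hT (hg ▸ Subgroup.mem_zpowers g)
  have h1 : g ∈ Subgroup.zpowers x := h.mem_zpowers_symm hgP hxC (hg ▸ hxT)
  have h2 : c ∈ Subgroup.zpowers x := (Subgroup.zpowers_le.2 h1) (hg ▸ Subgroup.mem_sup_right hc)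
  exact (h.mem_zpowers_pow_or hx h2).resolve_right
    fun h3 => hxC ((Subgroup.zpowers_le.2 hc) h3)

theorem centralizerIn_ne_bot (h : IsCyclicMaximalSplit p P A) : centralizerIn P A ≠ ⊥ :=
  fun hb => h.frattini_ne (eq_bot_iff.2 (hb ▸ h.frattini_le))

theorem eq_one_of_mem_zpowers_pow (h : IsCyclicMaximalSplit p P A) {s : G} (hs : s ∈ P)
    (hsp : s ∈ Subgroup.zpowers (s ^ p)) : s = 1 := by
  obtain ⟨k, hk⟩ := hsp
  exact congrArg Subtype.val (h.isPGroup.eq_one_of_mem_zpowers_pow h.prime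
    (x := ⟨s, hs⟩) ⟨k, Subtype.ext hk⟩)

theorem exists_quaternion_generators [Finite G] (h : IsCyclicMaximalSplit p P A)
    (hcyc : ∀ T ≤ P, T ≠ P → ∀ x ∈ T, x ∉ centralizerIn P A → ∃ g, T = Subgroup.zpowers g) :
    p = 2 ∧ ∃ u ∈ P, ∃ y ∈ P, u ^ 4 = 1 ∧ u ^ 2 ≠ 1 ∧ y ^ 2 = u ^ 2 ∧ u * y = y * u⁻¹ ∧
      u * y ≠ y * u := by
  obtain ⟨u, hu, v, hv, huv⟩ := h.exists_not_commute hcyc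
  have hnc : ∀ {x z : G}, x ∈ P → x * z ≠ z * x → x ∉ centralizerIn P A :=
    fun _ hxz hC => hxz (h.mul_comm_of_mem_centralizerIn hC _).symm
  have hpow : ∀ {x}, x ∈ P → x ∉ centralizerIn P A → x ^ p ≠ 1 := by
    intro x hx hxC hxp
    apply h.centralizerIn_ne_bot
    rw [h.centralizerIn_eq_zpowers_pow hcyc hx hxC, hxp, Subgroup.zpowers_one_eq_bot]
  have huC := hnc hu huv
  have hvC := hnc hv huv.symm
  have hCu := h.centralizerIn_eq_zpowers_pow hcyc hu huC
  have hCv := h.centralizerIn_eq_zpowers_pow hcyc hv hvC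
  -- Both `u ^ p` and `v ^ p` generate `C`, so some power `y` of `v` has `y ^ p` inverse to `u ^ p`;
  -- then `(uy) ^ p` reduces to a power of the commutator.
  obtain ⟨j, hj⟩ : (u ^ p)⁻¹ ∈ Subgroup.zpowers (v ^ p) := hCv ▸ inv_mem (h.pow_mem hu)
  set y := v ^ j with hydef
  have hyP : y ∈ P := zpow_mem hv j
  have hyp : y ^ p = (u ^ p)⁻¹ := by
    rw [← hj, hydef, ← zpow_natCast, ← zpow_natCast, ← zpow_mul, mul_comm, zpow_mul]
  have hyC : y ∉ centralizerIn P A := by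
    intro hC
    rw [hCu] at hC
    obtain ⟨l, hl⟩ := hC
    apply hpow hu huC
    apply h.eq_one_of_mem_zpowers_pow (_root_.pow_mem hu p)
    refine ⟨-l, ?_⟩
    have hl' : (u ^ p) ^ l = y := hl
    change ((u ^ p) ^ p) ^ (-l) = u ^ p
    rw [zpow_neg, ← inv_inj, inv_inv, ← hyp, ← hl', ← zpow_natCast (u ^ p) p, ← zpow_mul, mul_comm,
      zpow_mul, zpow_natCast]
  have huy : u * y ≠ y * u := by
    intro heq
    obtain ⟨i, hi⟩ := h.mem_zpowers_symm hv hyC ⟨j, rfl⟩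
    have hi' : y ^ i = v := hi
    apply huv
    rw [← hi']
    exact (show Commute u y from heq).zpow_right i
  set d := (u * y)⁻¹ * (y * u) with hddef
  have hyu : y * u = u * y * d := by rw [hddef]; group
  have hdC : d ∈ centralizerIn P A := by
    have := h.commutator_mem (inv_mem hyP) (inv_mem hu)
    simpa [hddef, mul_assoc] using this
  have hd := h.mul_comm_of_mem_centralizerIn hdC
  have hdp : d ^ p = 1 := by
    have h1 := pow_mul_eq_of_mul_eq_mul_mul hd hyu p
    rw [← h.mul_comm_of_mem_centralizerIn (h.pow_mem hyP) u] at h1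
    exact (mul_eq_left.1 h1.symm)
  have huyC : u * y ∉ centralizerIn P A := by
    refine hnc (z := u) (mul_mem hu hyP) fun heq => huy ?_
    rw [mul_assoc] at heq
    exact (mul_left_cancel heq).symm
  have huyp : (u * y) ^ p = d ^ p.choose 2 := by
    rw [mul_pow_of_mul_eq_mul_mul hd hyu, hyp]; simp
  -- For odd `p`, `p ∣ p.choose 2` would give `(uy) ^ p = 1` with `uy ∉ C`, so `C` would be trivial.
  have hp2 : p = 2 := by
    by_contra hp
    apply hpow (mul_mem hu hyP) huyC
    have : p ∣ p.choose 2 :=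
      h.prime.dvd_choose_self two_ne_zero (lt_of_le_of_ne h.prime.two_le (Ne.symm hp))
    obtain ⟨r, hr⟩ := this
    rw [huyp, hr, pow_mul, hdp, one_pow]
  subst hp2
  have hCd : centralizerIn P A = Subgroup.zpowers d := by
    rw [h.centralizerIn_eq_zpowers_pow hcyc (mul_mem hu hyP) huyC, huyp]; simp
  -- `C = ⟨d⟩` has exponent 2, so a nontrivial square can only be `d`.
  have hsq : ∀ {x}, x ∈ P → x ∉ centralizerIn P A → x ^ 2 = d := by
    intro x hx hxC
    have h1 : x ^ 2 ∈ Subgroup.zpowers d := hCd ▸ h.pow_mem hx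
    obtain ⟨k, hk⟩ := h1
    have hk' : d ^ k = x ^ 2 := hk
    rcases Int.even_or_odd' k with ⟨r, rfl | rfl⟩
    · exfalso
      apply hpow hx hxC
      rw [← hk', zpow_mul]
      norm_cast
      rw [hdp, one_zpow]
    · rw [← hk', zpow_add, zpow_mul]
      norm_cast
      rw [hdp, one_zpow, one_mul, pow_one]
  have hu2 := hsq hu huC
  refine ⟨rfl, u, hu, y, hyP, ?_, ?_, ?_, ?_, huy⟩
  · rw [show 4 = 2 * 2 from rfl, pow_mul, hu2, hdp]
  · exact hpow hu huC
  · rw [hu2, hsq hyP hyC]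
  · rw [eq_mul_inv_iff_mul_eq]
    calc u * y * u = u ^ 2 * y * d := by rw [mul_assoc, hyu, sq]; simp only [mul_assoc]
      _ = y * d ^ 2 := by rw [hu2, ← hd, sq, mul_assoc]
      _ = y := by rw [hdp, mul_one]

theorem nonempty_quaternion_equiv [Finite G] (h : IsCyclicMaximalSplit p P A)
    (hcyc : ∀ T ≤ P, T ≠ P → ∀ x ∈ T, x ∉ centralizerIn P A → ∃ g, T = Subgroup.zpowers g) :
    p = 2 ∧ Nonempty (QuaternionGroup 2 ≃* P) := by
  obtain ⟨hp, u, hu, y, hy, hu4, hu2, hy2, huy, hne⟩ := h.exists_quaternion_generators hcyc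
  refine ⟨hp, ?_⟩
  let f : QuaternionGroup 2 →* P := QuaternionGroup.liftOfRelations (⟨u, hu⟩ : P) ⟨y, hy⟩
    (Subtype.ext hu4) (Subtype.ext hy2) (Subtype.ext huy)
  have hfa : ∀ k : ℤ, (f (.a k) : G) = u ^ k := fun k =>
    congrArg Subtype.val (QuaternionGroup.liftOfRelations_a _ _ _ k)
  have hfxa : ∀ k : ℤ, (f (.xa k) : G) = y * u ^ k := fun k =>
    congrArg Subtype.val (QuaternionGroup.liftOfRelations_xa _ _ _ k)
  have hord : orderOf u = 4 := orderOf_eq_prime_pow (p := 2) (n := 1) hu2 hu4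
  refine ⟨MulEquiv.ofBijective f ⟨?_, ?_⟩⟩
  · rw [injective_iff_map_eq_one]
    rintro (i | i) hi
    · obtain ⟨i, rfl⟩ := ZMod.intCast_surjective i
      have h1 : u ^ i = 1 := by rw [← hfa, hi]; rfl
      rw [← orderOf_dvd_iff_zpow_eq_one, hord] at h1
      rw [QuaternionGroup.one_def]
      congr 1
      exact (ZMod.intCast_zmod_eq_zero_iff_dvd i (2 * 2)).2 (by exact_mod_cast h1)
    · obtain ⟨i, rfl⟩ := ZMod.intCast_surjective i
      have h1 : y * u ^ i = 1 := by rw [← hfxa, hi]; rfl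
      exfalso
      apply hne
      rw [eq_inv_of_mul_eq_one_left h1]
      exact ((Commute.refl u).zpow_right i).inv_right
  · let T : Subgroup G := f.range.map P.subtype
    have hT : T ≤ P := Subgroup.map_subtype_le _
    have huT : u ∈ T := ⟨⟨u, hu⟩, ⟨.a ((1 : ℤ) : ZMod _), Subtype.ext (by rw [hfa]; simp)⟩, rfl⟩
    have hyT : y ∈ T := ⟨⟨y, hy⟩, ⟨.xa ((0 : ℤ) : ZMod _), Subtype.ext (by rw [hfxa]; simp)⟩, rfl⟩
    -- The image contains the noncommuting `u` and `y`, so it is not cyclic and cannot be proper.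
    have hTP : T = P := by
      by_contra hne'
      obtain ⟨g, hg⟩ := hcyc T hT hne' u huT
        fun hC => hne (h.mul_comm_of_mem_centralizerIn hC _).symm
      rw [hg] at huT hyT
      obtain ⟨i, rfl⟩ := huT
      obtain ⟨j, rfl⟩ := hyT
      exact hne ((Commute.refl g).zpow_zpow i j)
    rintro ⟨z, hz⟩
    obtain ⟨w, ⟨q, hq⟩, hw⟩ := hTP.symm ▸ hz
    exact ⟨q, hq.trans (Subtype.ext hw)⟩

end IsCyclicMaximalSplit

/-! ### The action of `A` on `Q₈` and the splitting of `G`. -/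

theorem MulAction.index_dvd_card_of_stabilizer_eq {α X : Type*} [Group α] [MulAction α X]
    [Finite α] [Finite X] {N : Subgroup α} (hN : ∀ x : X, MulAction.stabilizer α x = N) :
    N.index ∣ Nat.card X := by
  classical
  have := Fintype.ofFinite α
  have := Fintype.ofFinite X
  rw [Nat.card_eq_fintype_card, MulAction.card_eq_sum_card_group_div_card_stabilizer α X]
  refine Finset.dvd_sum fun ω _ => ?_
  rw [← Nat.card_eq_fintype_card, ← Nat.card_eq_fintype_card, hN, ← N.card_mul_index,
    Nat.mul_div_cancel_left _ Nat.card_pos]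

theorem quaternionGroup_two_eq_of_central :
    ∀ q : QuaternionGroup 2, (∀ r, r * q = q * r) → q = 1 ∨ q = .a 2 := by decide

theorem quaternionGroup_two_sq :
    ∀ q : QuaternionGroup 2, q ≠ 1 → q ≠ .a 2 → q ^ 2 = .a 2 := by decide

theorem quaternionGroup_two_a_two_sq : (.a 2 : QuaternionGroup 2) ^ 2 = 1 := by decide

theorem quaternionGroup_two_a_two_ne : (.a 2 : QuaternionGroup 2) ≠ 1 := by decide

theorem card_of_quaternionGroup_two_equiv {H : Type*} [Group H] (e : QuaternionGroup 2 ≃* H) :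
    Nat.card H = 8 := by
  rw [← Nat.card_congr e.toEquiv, Nat.card_eq_fintype_card, QuaternionGroup.card]

namespace IsCyclicMaximalSplit

variable {G : Type*} [Group G] [Finite G] {p : ℕ} {P A : Subgroup G}

theorem mem_centralizerIn_iff_of_quaternion (h : IsCyclicMaximalSplit p P A)
    (e : QuaternionGroup 2 ≃* P) (q : QuaternionGroup 2) :
    (e q : G) ∈ centralizerIn P A ↔ q = 1 ∨ q = .a 2 := by
  have key : ∀ q : QuaternionGroup 2, (e q : G) ∈ centralizerIn P A → q = 1 ∨ q = .a 2 := by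
    refine fun q hq => quaternionGroup_two_eq_of_central q fun r => e.injective (Subtype.ext ?_)
    simpa using h.mul_comm_of_mem_centralizerIn hq (e r)
  refine ⟨key q, ?_⟩
  rintro (rfl | rfl)
  · simp
  · obtain ⟨⟨c, hc⟩, hc1⟩ := Subgroup.ne_bot_iff_exists_ne_one.1 h.centralizerIn_ne_bot
    obtain ⟨q, hq⟩ := e.surjective ⟨c, hc.1⟩
    have hq' : (e q : G) = c := congrArg Subtype.val hq
    rcases key q (hq' ▸ hc) with rfl | rfl
    · exact absurd (Subtype.ext (by simpa using hq'.symm)) hc1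
    · exact hq' ▸ hc

theorem card_centralizerIn (h : IsCyclicMaximalSplit p P A) (e : QuaternionGroup 2 ≃* P) :
    Nat.card (centralizerIn P A) = 2 := by
  have : ((centralizerIn P A : Subgroup G) : Set G) = {1, (e (.a 2) : G)} := by
    ext c
    constructor
    · intro hc
      obtain ⟨q, hq⟩ := e.surjective ⟨c, hc.1⟩
      have hq' : (e q : G) = c := congrArg Subtype.val hq
      rcases (h.mem_centralizerIn_iff_of_quaternion e q).1 (hq' ▸ hc) with rfl | rfl
      · exact Or.inl (by simpa using hq'.symm)
      · exact Or.inr hq'.symm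
    · rintro (rfl | rfl)
      · exact one_mem _
      · exact (h.mem_centralizerIn_iff_of_quaternion e _).2 (Or.inr rfl)
  rw [← SetLike.coe_sort_coe, Nat.card_coe_set_eq, this, Set.ncard_pair]
  intro h1
  exact quaternionGroup_two_a_two_ne (e.injective (Subtype.ext (by simpa using h1.symm)))

theorem orderOf_eq_four (h : IsCyclicMaximalSplit p P A) (e : QuaternionGroup 2 ≃* P) {x : G}
    (hx : x ∈ P) (hxC : x ∉ centralizerIn P A) : orderOf x = 4 := by
  obtain ⟨q, hq⟩ := e.surjective ⟨x, hx⟩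
  have hq' : (e q : G) = x := congrArg Subtype.val hq
  rw [← hq', h.mem_centralizerIn_iff_of_quaternion e, not_or] at hxC
  have h2 : x ^ 2 = e (.a 2) := by
    rw [← quaternionGroup_two_sq q hxC.1 hxC.2, map_pow, ← hq']; rfl
  refine orderOf_eq_prime_pow (p := 2) (n := 1) ?_ ?_
  · rw [pow_one, h2]
    exact fun h1 => quaternionGroup_two_a_two_ne (e.injective (Subtype.ext (by simpa using h1)))
  · rw [show 2 ^ (1 + 1) = 2 * 2 from rfl, pow_mul, h2]
    have := congrArg (fun q => (e q : G)) quaternionGroup_two_a_two_sq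
    simpa using this

/-- `A` acts by conjugation on the six elements of `P \ C` with every stabilizer equal to `K`, so
the index divides 6; it is odd since `|A|` is, and not 1 since `A` does not centralize `P`. -/
theorem relIndex_eq_three (h : IsCyclicMaximalSplit 2 P A) (e : QuaternionGroup 2 ≃* P) :
    (centralizerIn A P).relIndex A = 3 := by
  let X := ((P : Set G) \ (centralizerIn P A : Set G) : Set G)
  have hX : Nat.card X = 6 := by
    have h1 : ((centralizerIn P A : Subgroup G) : Set G) ⊆ P := fun x hx => hx.1
    rw [Nat.card_coe_set_eq, Set.ncard_sdiff h1, ← Nat.card_coe_set_eq, ← Nat.card_coe_set_eq,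
      SetLike.coe_sort_coe, SetLike.coe_sort_coe, card_of_quaternionGroup_two_equiv e, h.card_centralizerIn e]
  let _ : MulAction A X :=
    { smul a x := ⟨a * x * (a : G)⁻¹, h.normal.conj_mem _ x.2.1 a, fun hC => x.2.2 (by
        simpa [mul_assoc] using h.normal_centralizer.conj_mem _ hC (a : G)⁻¹)⟩
      one_smul x := Subtype.ext (by
        change ((1 : A) : G) * x * ((1 : A) : G)⁻¹ = x
        simp)
      mul_smul a b x := Subtype.ext (by
        change ((a * b : A) : G) * x * ((a * b : A) : G)⁻¹
          = a * (b * x * (b : G)⁻¹) * (a : G)⁻¹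
        simp [mul_assoc]) }
  have hstab : ∀ x : X, MulAction.stabilizer A x = (centralizerIn A P).subgroupOf A := by
    intro x
    ext a
    rw [MulAction.mem_stabilizer_iff, Subgroup.mem_subgroupOf]
    have h1 : a • x = x ↔ (a : G) * x * (a : G)⁻¹ = x := Subtype.ext_iff
    rw [h1, mul_inv_eq_iff_eq_mul]
    constructor
    · intro h2
      exact (h.mem_or_mem_of_commute x.2.1 a.2 h2.symm).resolve_left x.2.2
    · intro h2
      exact ((mem_centralizerIn.1 h2).2 x x.2.1).symm
  have hdvd := MulAction.index_dvd_card_of_stabilizer_eq hstab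
  rw [hX] at hdvd
  change (centralizerIn A P).relIndex A ∣ 6 at hdvd
  have hne : (centralizerIn A P).relIndex A ≠ 1 := by
    intro h1
    obtain ⟨b, hb, hbK⟩ := h.exists_notMem_symm
    exact hbK (Subgroup.relIndex_eq_one.1 h1 hb)
  have hodd : ¬ 2 ∣ (centralizerIn A P).relIndex A := by
    intro h2
    have h3 : (centralizerIn A P).relIndex A ∣ Nat.card A :=
      Subgroup.index_dvd_card _
    exact (Nat.Prime.coprime_iff_not_dvd Nat.prime_two).1 h.coprime (h2.trans h3)
  have hle := Nat.le_of_dvd (by norm_num) hdvd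
  interval_cases (centralizerIn A P).relIndex A <;> simp_all

theorem pow_three_mem (h : IsCyclicMaximalSplit 2 P A) (e : QuaternionGroup 2 ≃* P) {a : G}
    (ha : a ∈ A) : a ^ 3 ∈ centralizerIn A P := by
  have hn : ((centralizerIn A P).subgroupOf A).Normal :=
    h.normal_centralizerIn_symm.subgroupOf A
  have h1 := Subgroup.pow_index_mem ((centralizerIn A P).subgroupOf A) ⟨a, ha⟩
  rw [show ((centralizerIn A P).subgroupOf A).index = 3 from h.relIndex_eq_three e] at h1
  exact h1

theorem exists_mulEquiv_of_quaternion (h : IsCyclicMaximalSplit 2 P A)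
    (e : QuaternionGroup 2 ≃* P) :
    ∃ (k m : ℕ) (φ : Multiplicative (ZMod (3 ^ k)) →* MulAut (QuaternionGroup 2)),
      m.Coprime 6 ∧ Nonempty (G ≃* (QuaternionGroup 2 ⋊[φ] Multiplicative (ZMod (3 ^ k))) ×
        Multiplicative (ZMod m)) := by
  have hn0 : Nat.card A ≠ 0 := Nat.card_pos.ne'
  obtain ⟨k, m, h3m, hkm⟩ := Nat.exists_eq_pow_mul_and_not_dvd hn0 3 (by norm_num)
  have hodd : ¬ 2 ∣ Nat.card A := (Nat.Prime.coprime_iff_not_dvd Nat.prime_two).1 h.coprime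
  have hm0 : m ≠ 0 := by rintro rfl; simp at h3m
  have hk0 : k ≠ 0 := by
    rintro rfl
    have h1 : 3 ∣ Nat.card A :=
      (h.relIndex_eq_three e) ▸ Subgroup.index_dvd_card ((centralizerIn A P).subgroupOf A)
    rw [hkm, pow_zero, one_mul] at h1
    exact h3m h1
  have hm6 : m.Coprime 6 := by
    rw [show 6 = 2 * 3 from rfl, Nat.coprime_mul_iff_right]
    exact ⟨((Nat.Prime.coprime_iff_not_dvd Nat.prime_two).2
      fun h2 => hodd (hkm ▸ h2.mul_left _)).symm,
      ((Nat.Prime.coprime_iff_not_dvd Nat.prime_three).2 h3m).symm⟩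
  obtain ⟨⟨a, ha⟩, hgen⟩ := h.cyclic.exists_generator
  have hgenA : A = Subgroup.zpowers a := by
    refine le_antisymm (fun b hb => ?_) (Subgroup.zpowers_le.2 ha)
    obtain ⟨i, hi⟩ := hgen ⟨b, hb⟩
    exact ⟨i, congrArg Subtype.val hi⟩
  have hord : orderOf a = 3 ^ k * m := by rw [← hkm, hgenA, Nat.card_zpowers]
  have hB : Nat.card (Subgroup.zpowers (a ^ m)) = 3 ^ k := by
    rw [Nat.card_zpowers, orderOf_pow_of_dvd hm0 (hord ▸ dvd_mul_left _ _), hord,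
      Nat.mul_div_cancel _ (Nat.pos_of_ne_zero hm0)]
  have hD : Nat.card (Subgroup.zpowers (a ^ 3 ^ k)) = m := by
    rw [Nat.card_zpowers, orderOf_pow_of_dvd (by positivity) (hord ▸ dvd_mul_right _ _), hord,
      Nat.mul_div_cancel_left _ (by positivity)]
  -- Here `k ≥ 1` is needed: `a ^ 3 ^ k` is a power of `a ^ 3 ∈ K`.
  have hDK : Subgroup.zpowers (a ^ 3 ^ k) ≤ Subgroup.center G := by
    rw [Subgroup.zpowers_le]
    obtain ⟨j, rfl⟩ := Nat.exists_eq_succ_of_ne_zero hk0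
    rw [pow_succ', pow_mul]
    exact h.centralizerIn_symm_le_center (_root_.pow_mem (h.pow_three_mem e ha) _)
  have : NeZero m := ⟨hm0⟩
  have := h.normal
  let θ : Multiplicative (ZMod (3 ^ k)) ≃* Subgroup.zpowers (a ^ m) :=
    mulEquivOfCyclicCardEq (by rw [hB]; simp)
  let δ : Multiplicative (ZMod m) ≃* Subgroup.zpowers (a ^ 3 ^ k) :=
    mulEquivOfCyclicCardEq (by rw [hD]; simp)
  let θ' : Multiplicative (ZMod (3 ^ k)) →* G := (Subgroup.subtype _).comp θ.toMonoidHom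
  let δ' : Multiplicative (ZMod m) →* G := (Subgroup.subtype _).comp δ.toMonoidHom
  let e' : QuaternionGroup 2 →* G := P.subtype.comp e.toMonoidHom
  let φ : Multiplicative (ZMod (3 ^ k)) →* MulAut (QuaternionGroup 2) :=
    (MulAut.congr e.symm).toMonoidHom.comp ((MulAut.conjNormal (H := P)).comp θ')
  let f : QuaternionGroup 2 ⋊[φ] Multiplicative (ZMod (3 ^ k)) →* G :=
    SemidirectProduct.lift e' θ' (by
      intro g
      ext q
      have : e (φ g q) = MulAut.conjNormal (θ' g) (e q) := e.apply_symm_apply _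
      change ((e (φ g q) : P) : G) = θ' g * e q * (θ' g)⁻¹
      rw [this, MulAut.conjNormal_apply])
  let F : (QuaternionGroup 2 ⋊[φ] Multiplicative (ZMod (3 ^ k))) × Multiplicative (ZMod m) →* G :=
    MonoidHom.noncommCoprod f δ' fun x d => Subgroup.mem_center_iff.1 (hDK (δ d).2) (f x)
  have hcard : Nat.card ((QuaternionGroup 2 ⋊[φ] Multiplicative (ZMod (3 ^ k))) ×
      Multiplicative (ZMod m)) = Nat.card G := by
    rw [Nat.card_prod, SemidirectProduct.card, ← h.compl.card_mul_card, hkm,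
      Nat.card_congr e.toEquiv]
    simp [mul_assoc]
  have hPF : P ≤ F.range := fun x hx =>
    ⟨(SemidirectProduct.inl (e.symm ⟨x, hx⟩), 1), by
      change f _ * δ' 1 = x
      rw [map_one, mul_one, SemidirectProduct.lift_inl]
      exact congrArg Subtype.val (e.apply_symm_apply _)⟩
  have hBF : a ^ m ∈ F.range :=
    ⟨(SemidirectProduct.inr (θ.symm ⟨a ^ m, Subgroup.mem_zpowers _⟩), 1), by
      change f _ * δ' 1 = a ^ m
      rw [map_one, mul_one, SemidirectProduct.lift_inr]
      exact congrArg Subtype.val (θ.apply_symm_apply _)⟩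
  have hDF : a ^ 3 ^ k ∈ F.range :=
    ⟨(1, δ.symm ⟨a ^ 3 ^ k, Subgroup.mem_zpowers _⟩), by
      change f 1 * δ' _ = a ^ 3 ^ k
      rw [map_one, one_mul]
      exact congrArg Subtype.val (δ.apply_symm_apply _)⟩
  have hcop : IsCoprime (m : ℤ) ((3 ^ k : ℕ) : ℤ) := Nat.isCoprime_iff_coprime.2
    (((Nat.Prime.coprime_iff_not_dvd Nat.prime_three).2 h3m).symm.pow_right k)
  have haF : a ∈ F.range := by
    obtain ⟨i, j, hij⟩ := hcop
    have : a = (a ^ m) ^ i * (a ^ 3 ^ k) ^ j := by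
      rw [← zpow_natCast, ← zpow_natCast, ← zpow_mul, ← zpow_mul, ← zpow_add, mul_comm _ i,
        mul_comm _ j, hij, zpow_one]
    rw [this]
    exact mul_mem (zpow_mem hBF i) (zpow_mem hDF j)
  have hsurj : Function.Surjective F := by
    rw [← MonoidHom.range_eq_top, eq_top_iff, ← h.compl.sup_eq_top]
    exact sup_le hPF (hgenA.le.trans (Subgroup.zpowers_le.2 haF))
  have : NeZero (3 ^ k) := ⟨by positivity⟩
  have hfin : Finite ((QuaternionGroup 2 ⋊[φ] Multiplicative (ZMod (3 ^ k))) ×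
      Multiplicative (ZMod m)) := Nat.finite_of_card_ne_zero (hcard ▸ Nat.card_pos.ne')
  exact ⟨k, m, φ, hm6,
    ⟨(MulEquiv.ofBijective F (hsurj.bijective_of_nat_card_le hcard.le)).symm⟩⟩

end IsCyclicMaximalSplit

/-! ### The converse: counting covers for `Q₈`, and recognizing `Q₈` inside (b). -/

theorem QuotientGroup.mk_mul_of_mem_left {G : Type*} [Group G] {N : Subgroup G} [N.Normal] {x : G}
    (hx : x ∈ N) (b : G) : ((x * b : G) : G ⧸ N) = b := by
  rw [QuotientGroup.mk_mul, (QuotientGroup.eq_one_iff x).2 hx, one_mul]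

namespace IsCyclicMaximalSplit

variable {G : Type*} [Group G] {p : ℕ} {P A : Subgroup G}

theorem le_of_mem_of_notMem [Finite G] (h : IsCyclicMaximalSplit 2 P A) (e : QuaternionGroup 2 ≃* P)
    {H : Subgroup G} (hKH : centralizerIn A P ≤ H) {b : G} (hb : b ∈ A)
    (hbK : b ∉ centralizerIn A P) (hbH : b ∈ H) : A ≤ H := by
  obtain ⟨⟨a, ha⟩, hgen⟩ := h.cyclic.exists_generator
  have h3 : a ^ 3 ∈ H := hKH (h.pow_three_mem e ha)
  obtain ⟨i, hi⟩ := hgen ⟨b, hb⟩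
  have hi' : a ^ i = b := congrArg Subtype.val hi
  have hi3 : ¬ (3 : ℤ) ∣ i := by
    rintro ⟨j, rfl⟩
    apply hbK
    rw [← hi', zpow_mul]
    exact zpow_mem (by exact_mod_cast h.pow_three_mem e ha) j
  obtain ⟨r, s, hrs⟩ := Int.prime_three.coprime_iff_not_dvd.2 hi3
  have haH : a ∈ H := by
    have : a = (a ^ 3) ^ r * b ^ s := by
      rw [← hi', ← zpow_natCast, ← zpow_mul, ← zpow_mul, ← zpow_add, mul_comm _ r, mul_comm i]
      push_cast
      rw [hrs, zpow_one]
    rw [this]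
    exact mul_mem (zpow_mem h3 r) (zpow_mem hbH s)
  intro c hc
  obtain ⟨j, hj⟩ := hgen ⟨c, hc⟩
  have hj' : a ^ j = c := congrArg Subtype.val hj
  exact hj' ▸ zpow_mem haH j

theorem isCoatom_sup_symm [Finite G] (h : IsCyclicMaximalSplit 2 P A) (e : QuaternionGroup 2 ≃* P) :
    IsCoatom (P ⊔ centralizerIn A P) := by
  refine ⟨h.sup_symm_ne_top le_rfl, fun H hH => ?_⟩
  obtain ⟨hle, g, hgH, hg⟩ := SetLike.lt_iff_le_and_exists.1 hH
  obtain ⟨x, hx, b, hb, rfl⟩ := h.exists_mul_eq g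
  have hPH : P ≤ H := le_sup_left.trans hle
  have hbK : b ∉ centralizerIn A P := fun hbK =>
    hg (mul_mem (Subgroup.mem_sup_left hx) (Subgroup.mem_sup_right hbK))
  have hAH := h.le_of_mem_of_notMem e (le_sup_right.trans hle) hb hbK
    ((Subgroup.mul_mem_cancel_left _ (hPH hx)).1 hgH)
  rw [eq_top_iff, ← h.compl.sup_eq_top]
  exact sup_le hPH hAH

/-- Raising to the power `|A|` kills `k` and keeps a generator of `⟨x⟩`. -/
theorem mem_of_mul_mem (h : IsCyclicMaximalSplit p P A) {H : Subgroup G} {x k : G} (hx : x ∈ P)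
    (hk : k ∈ centralizerIn A P) (hxk : x * k ∈ H) : x ∈ H := by
  have h1 : (x * k) ^ Nat.card A ∈ H := _root_.pow_mem hxk _
  rw [(show Commute x k from h.mul_comm_of_mem_centralizerIn_symm hk x).mul_pow,
    pow_card_eq_one hk.1, mul_one] at h1
  have h2 := h.isPGroup.orderOf_coprime h.coprime ⟨x, hx⟩
  rw [Subgroup.orderOf_mk] at h2
  obtain ⟨j, hj⟩ := exists_pow_eq_self_of_coprime h2.symm
  exact hj ▸ _root_.pow_mem h1 j

theorem eq_zpowers_of_quaternion [Finite G] (h : IsCyclicMaximalSplit p P A) (e : QuaternionGroup 2 ≃* P)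
    {T : Subgroup G} (hT : T ≤ P) (hTP : T ≠ P) {x : G} (hx : x ∈ T)
    (hxC : x ∉ centralizerIn P A) : T = Subgroup.zpowers x := by
  have h8 := card_of_quaternionGroup_two_equiv e
  have h4 : Nat.card (Subgroup.zpowers x) = 4 := by
    rw [Nat.card_zpowers, h.orderOf_eq_four e (hT hx) hxC]
  have hle : Subgroup.zpowers x ≤ T := Subgroup.zpowers_le.2 hx
  obtain ⟨r, hr⟩ := Subgroup.card_dvd_of_le hle
  obtain ⟨s, hs⟩ := Subgroup.card_dvd_of_le hT
  rw [h4] at hr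
  rw [h8, hr] at hs
  have hr2 : r ≠ 2 := by
    rintro rfl
    exact hTP (Subgroup.eq_of_le_of_card_ge hT (by rw [h8, hr]))
  have hr1 : r = 1 := by
    have h1 : r ∣ 2 := ⟨s, by linarith⟩
    exact ((Nat.dvd_prime Nat.prime_two).1 h1).resolve_right hr2
  exact (Subgroup.eq_of_le_of_card_ge hle (by rw [h4, hr, hr1])).symm

theorem centralizerIn_le_zpowers [Finite G] (h : IsCyclicMaximalSplit 2 P A) (e : QuaternionGroup 2 ≃* P)
    {x : G} (hx : x ∈ P) (hxC : x ∉ centralizerIn P A) :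
    centralizerIn P A ≤ Subgroup.zpowers x := by
  have h1 : Nat.card (Subgroup.zpowers (x ^ 2)) = 2 := by
    rw [Nat.card_zpowers, orderOf_pow_of_dvd two_ne_zero] <;> rw [h.orderOf_eq_four e hx hxC]
    norm_num
  have h2 := Subgroup.eq_of_le_of_card_ge (Subgroup.zpowers_le.2 (h.pow_mem hx))
    (by rw [h1, h.card_centralizerIn e])
  rw [← h2, Subgroup.zpowers_le]
  exact _root_.pow_mem (Subgroup.mem_zpowers x) 2

/-- An element outside `P ⊔ C_A(P)` cannot normalize `⟨x⟩`. -/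
theorem le_sup_symm_of_inf_eq_zpowers [Finite G] (h : IsCyclicMaximalSplit 2 P A)
    (e : QuaternionGroup 2 ≃* P) {H : Subgroup G} {x : G} (hx : x ∈ P)
    (hxC : x ∉ centralizerIn P A) (hH : P ⊓ H = Subgroup.zpowers x) :
    H ≤ P ⊔ centralizerIn A P := by
  intro g hg
  obtain ⟨y, hy, b, hb, rfl⟩ := h.exists_mul_eq g
  by_contra hgP
  have hbK : b ∉ centralizerIn A P := fun hbK =>
    hgP (mul_mem (Subgroup.mem_sup_left hy) (Subgroup.mem_sup_right hbK))
  have hxH : x ∈ H := (hH.ge (Subgroup.mem_zpowers x)).2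
  set t := y * b * x * (y * b)⁻¹ with ht
  have htP : t ∈ P := h.normal.conj_mem x hx (y * b)
  have ht1 : t ∈ Subgroup.zpowers x :=
    hH.le (Subgroup.mem_inf.2 ⟨htP, H.mul_mem (H.mul_mem hg hxH) (H.inv_mem hg)⟩)
  have hbx : b * x * b⁻¹ ∈ Subgroup.zpowers x := by
    -- The factor `y` only contributes a commutator of `P`, which lies in `C ≤ ⟨x⟩`; so `b` alone
    -- normalizes `⟨x⟩`.
    have h1 : b * x * b⁻¹ = t * (t⁻¹ * y⁻¹ * t⁻¹⁻¹ * y⁻¹⁻¹) := by rw [ht]; group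
    rw [h1]
    exact mul_mem ht1 (h.centralizerIn_le_zpowers e hx hxC
      (h.commutator_mem (inv_mem htP) (inv_mem hy)))
  obtain ⟨i, hi⟩ := hbx
  have hi' : x ^ i = b * x * b⁻¹ := hi
  have hx2 : ∀ j : ℤ, x ^ (2 * j) ∈ centralizerIn P A := fun j => by
    rw [zpow_mul]
    exact zpow_mem (by exact_mod_cast h.pow_mem hx) j
  have hcomm : x⁻¹ * b * x⁻¹⁻¹ * b⁻¹ ∈ centralizerIn P A := by
    have h1 : x⁻¹ * b * x⁻¹⁻¹ * b⁻¹ = x ^ (i - 1) := by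
      rw [zpow_sub_one, hi']
      have : Commute (x ^ i) x⁻¹ := ((Commute.refl x).zpow_left i).inv_right
      rw [hi'] at this
      rw [this.eq]; group
    rw [h1]
    -- An even `i` would put a conjugate of `x` in `C`; for odd `i` the commutator `x ^ (i - 1)`
    -- lies in `C`, so `b` commutes with `x`.
    rcases Int.even_or_odd' i with ⟨j, rfl | rfl⟩
    · exfalso
      have h2 := hx2 j
      rw [hi'] at h2
      have h3 := h.normal_centralizer.conj_mem _ h2 b⁻¹
      exact hxC (by simpa [mul_assoc] using h3)
    · simpa using hx2 j
  rcases h.mem_or_mem_of_commute (inv_mem hx) hb (h.commute_of_commutator_mem hb hcomm) with h1 | h1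
  · exact hxC (inv_mem_iff.1 h1)
  · exact hbK h1

theorem irredundantCoverCount_of_quaternion [Finite G] (h : IsCyclicMaximalSplit 2 P A)
    (e : QuaternionGroup 2 ≃* P) : irredundantCoverCount G = 2 := by
  obtain ⟨x₀, hx₀, hx₀C⟩ := h.exists_notMem
  have hz₀ : Subgroup.zpowers x₀ ≤ P := Subgroup.zpowers_le.2 hx₀
  have c1 := h.isIrredundantCover_coverWith_sup le_rfl hx₀ hx₀C
  have c2 := h.isIrredundantCover_coverWith_sup hz₀ (Subgroup.mem_zpowers x₀) hx₀C
  rw [irredundantCoverCount, Set.ncard_eq_two]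
  refine ⟨_, _, fun heq => h.ne_zpowers (h.eq_zpowers_of_coverWith_eq le_rfl hx₀ hx₀C heq), ?_⟩
  ext S
  refine ⟨fun hS => ?_, ?_⟩
  · have hconj := h.conjugates_subset hS.1
    by_cases hPS : ∃ H ∈ S, P ⊔ centralizerIn A P ≤ H
    · left
      obtain ⟨H, hH, hle⟩ := hPS
      have hHeq := ((h.isCoatom_sup_symm e).le_iff.1 hle).resolve_left (hS.1.1 H hH)
      refine (hS.eq_of_subset c1.1 ?_).symm
      rw [coverWith_sup]
      exact Set.union_subset hconj (Set.singleton_subset_iff.2 (hHeq ▸ hH))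
    · right
      push Not at hPS
      refine (hS.eq_of_subset c2.1 ?_).symm
      rw [h.coverWith_zpowers hx₀ hx₀C]
      refine Set.union_subset hconj ?_
      rintro _ ⟨x, hx, hxC, rfl⟩
      have := h.cyclic
      obtain ⟨⟨k, hk⟩, hgen⟩ := (Subgroup.isCyclic_of_le
        (inf_le_left : centralizerIn A P ≤ A)).exists_generator
      -- With `k` a generator of `K`, the member containing `xk` contains both `x` and `K`; not
      -- containing `PK`, it must be `⟨x⟩K`.
      obtain ⟨H, hH, hxkH⟩ := hS.1.exists_mem (x * k)
      have hxH := h.mem_of_mul_mem hx hk hxkH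
      have hkH : k ∈ H := (Subgroup.mul_mem_cancel_left _ hxH).1 hxkH
      have hKH : centralizerIn A P ≤ H := by
        intro l hl
        obtain ⟨i, hi⟩ := hgen ⟨l, hl⟩
        have hi' : k ^ i = l := congrArg Subtype.val hi
        exact hi' ▸ zpow_mem hkH i
      have hinf : P ⊓ H = Subgroup.zpowers x := h.eq_zpowers_of_quaternion e inf_le_left
        (fun heq => hPS H hH (sup_le (inf_eq_left.1 heq) hKH)) ⟨hx, hxH⟩ hxC
      have hle := h.le_sup_symm_of_inf_eq_zpowers e hx hxC hinf
      have : H = Subgroup.zpowers x ⊔ centralizerIn A P := by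
        refine le_antisymm (fun z hz => ?_) (sup_le (Subgroup.zpowers_le.2 hxH) hKH)
        obtain ⟨t, ht, l, hl, rfl⟩ := h.mem_sup_symm_iff.1 (hle hz)
        have htH : t ∈ H := (Subgroup.mul_mem_cancel_right _ (hKH hl)).1 hz
        exact mul_mem (Subgroup.mem_sup_left (hinf.le ⟨ht, htH⟩)) (Subgroup.mem_sup_right hl)
      exact this ▸ hH
  · rintro (rfl | rfl)
    exacts [c1, c2]

theorem commutator_mem_left (h : IsCyclicMaximalSplit p P A) (g k : G) :
    g * k * g⁻¹ * k⁻¹ ∈ P := by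
  have := h.normal
  obtain ⟨x, hx, b, hb, rfl⟩ := h.exists_mul_eq g
  obtain ⟨y, hy, c, hc, rfl⟩ := h.exists_mul_eq k
  rw [← QuotientGroup.eq_one_iff, QuotientGroup.mk_mul, QuotientGroup.mk_mul,
    QuotientGroup.mk_mul, QuotientGroup.mk_inv, QuotientGroup.mk_inv, QuotientGroup.mk_mul_of_mem_left hx,
    QuotientGroup.mk_mul_of_mem_left hy, ← QuotientGroup.mk_mul, h.mul_comm_of_mem hb hc, QuotientGroup.mk_mul]
  group

theorem mem_of_pow_eq_one (h : IsCyclicMaximalSplit p P A) {g : G} {r : ℕ}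
    (hr : r.Coprime (Nat.card A)) (hg : g ^ r = 1) : g ∈ P := by
  have := h.normal
  obtain ⟨x, hx, b, hb, rfl⟩ := h.exists_mul_eq g
  have h1 : b ^ r = 1 := by
    refine h.eq_one_of_mem_of_mem ?_ (_root_.pow_mem hb r)
    rw [← QuotientGroup.eq_one_iff, QuotientGroup.mk_pow, ← QuotientGroup.mk_mul_of_mem_left hx b,
      ← QuotientGroup.mk_pow, hg, QuotientGroup.mk_one]
  have h2 : b = 1 := orderOf_eq_one_iff.1 (Nat.eq_one_of_dvd_coprimes hr
    (orderOf_dvd_of_pow_eq_one h1) (orderOf_dvd_of_pow_eq_one (pow_card_eq_one hb)))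
  simpa [h2] using hx

theorem quaternion_of_mulEquiv [Finite G] (h : IsCyclicMaximalSplit p P A) {k m : ℕ}
    {φ : Multiplicative (ZMod (3 ^ k)) →* MulAut (QuaternionGroup 2)} (hm : m.Coprime 6)
    (ψ : G ≃* (QuaternionGroup 2 ⋊[φ] Multiplicative (ZMod (3 ^ k))) × Multiplicative (ZMod m)) :
    p = 2 ∧ Nonempty (QuaternionGroup 2 ≃* P) := by
  let ι : QuaternionGroup 2 →* G := ψ.symm.toMonoidHom.comp
    ((MonoidHom.inl _ _).comp SemidirectProduct.inl)
  have hι : Function.Injective ι := ψ.symm.injective.comp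
    ((Prod.mk_left_injective _).comp SemidirectProduct.inl_injective)
  have hz1 : ι (.a 2) ≠ 1 := fun h1 =>
    quaternionGroup_two_a_two_ne (hι (by rw [h1, map_one]))
  have hz2 : ι (.a 2) ^ 2 = 1 := by rw [← map_pow, quaternionGroup_two_a_two_sq, map_one]
  -- The central involution is a commutator, and `G/P` is abelian; being in `P`, it forces `p = 2`.
  have hzP : ι (.a 2) ∈ P := by
    have h1 : (.a 2 : QuaternionGroup 2) = .a 1 * .xa 0 * (.a 1)⁻¹ * (.xa 0)⁻¹ := by decide
    rw [h1, map_mul, map_mul, map_mul, map_inv, map_inv]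
    exact h.commutator_mem_left _ _
  have hp2 : p = 2 := by
    have := Fact.mk h.prime
    have h1 := h.isPGroup.dvd_orderOf (g := ⟨_, hzP⟩) (fun h1 => hz1 (congrArg Subtype.val h1))
    rw [Subgroup.orderOf_mk] at h1
    exact (Nat.prime_dvd_prime_iff_eq h.prime Nat.prime_two).1
      (h1.trans (orderOf_dvd_of_pow_eq_one hz2))
  refine ⟨hp2, ?_⟩
  subst hp2
  have hιP : ∀ q, ι q ∈ P := by
    intro q
    refine h.mem_of_pow_eq_one (r := 2 ^ 2) (h.coprime.pow_left 2) ?_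
    rw [← map_pow, show q ^ (2 ^ 2) = 1 by revert q; decide, map_one]
  let f : QuaternionGroup 2 →* P := ι.codRestrict P hιP
  have hf : Function.Injective f := fun q r hqr => hι (congrArg Subtype.val hqr)
  have hQ : Nat.card (QuaternionGroup 2) = 8 := card_of_quaternionGroup_two_equiv (.refl _)
  -- `|P|` is a power of 2 dividing `8 · 3 ^ k · m` with `m` odd, so the embedded `Q₈` fills `P`.
  have hcard : Nat.card P ∣ 8 := by
    have h1 : Nat.card P * Nat.card A = 8 * (3 ^ k * m) := by
      rw [h.compl.card_mul_card, Nat.card_congr ψ.toEquiv, Nat.card_prod, SemidirectProduct.card,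
        hQ, Nat.card_congr Multiplicative.toAdd, Nat.card_congr Multiplicative.toAdd, Nat.card_zmod,
        Nat.card_zmod, mul_assoc]
    have : Fact (Nat.Prime 2) := ⟨Nat.prime_two⟩
    obtain ⟨r, hr⟩ := IsPGroup.iff_card.1 h.isPGroup
    have hcop : (Nat.card P).Coprime (3 ^ k * m) := by
      rw [hr]
      refine Nat.Coprime.pow_left r
        (Nat.Coprime.mul_right ((by norm_num : Nat.Coprime 2 3).pow_right k) ?_)
      exact (hm.coprime_dvd_right (by norm_num : 2 ∣ 6)).symm
    exact hcop.dvd_of_dvd_mul_right ⟨_, h1.symm⟩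
  exact ⟨MulEquiv.ofBijective f (hf.bijective_of_nat_card_le
    ((Nat.le_of_dvd (by norm_num) hcard).trans hQ.ge))⟩

end IsCyclicMaximalSplit

theorem mainTheorem4 {G : Type*} [Group G] [Finite G] (p n : ℕ) (hp : p.Prime)
    (hpn : p.Coprime n) (P A : Subgroup G) (hP : IsPGroup p P)
    -- `G = P ⋊ A` (internally) with `A` cyclic of order `n`
    (hPnormal : P.Normal) (hPA : P.IsComplement' A) (hA : IsCyclic A) (hAcard : Nat.card A = n)
    (hG : ¬ Group.IsNilpotent G)
    -- `C_P(A) × A` (the subgroup generated by `C_P(A)` and `A`) is a cyclic maximal subgroup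
    (hcyclic : IsCyclic ↥(centralizerIn P A ⊔ A)) (hmax : IsCoatom (centralizerIn P A ⊔ A))
    (hfrattini : frattiniIn P ≤ centralizerIn P A) (hfrattini_ne : frattiniIn P ≠ ⊥)
    (hCnormal : (centralizerIn P A).Normal) :
    irredundantCoverCount G = 2 ↔
      (∃ t q : ℕ, 1 < t ∧ q.Prime ∧ q ^ 2 ∣ n ∧
        Nonempty (P ≃* Multiplicative (ZMod (p ^ t))) ∧
        Nonempty (Subgroup.center G ≃*
          Multiplicative (ZMod (p ^ (t - 1))) × Multiplicative (ZMod (n / q ^ 2)))) ∨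
      (∃ (k m : ℕ) (φ : Multiplicative (ZMod (3 ^ k)) →* MulAut (QuaternionGroup 2)),
        m.Coprime 6 ∧
        Nonempty (G ≃* (QuaternionGroup 2 ⋊[φ] Multiplicative (ZMod (3 ^ k))) ×
          Multiplicative (ZMod m))) := by
  have h : IsCyclicMaximalSplit p P A := ⟨hp, hAcard ▸ hpn, hP, hPnormal, hPA, hA, hG, hcyclic,
    hmax, hfrattini, hfrattini_ne, hCnormal⟩
  constructor
  · intro hβ
    right
    obtain ⟨rfl, ⟨e⟩⟩ := h.nonempty_quaternion_equiv fun T hT hTP x hx hxC =>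
      h.zpowers_of_irredundantCoverCount_eq_two h.ne_zpowers hβ hT hTP hx hxC
    exact h.exists_mulEquiv_of_quaternion e
  · rintro (⟨t, -, -, -, -, ⟨f⟩, -⟩ | ⟨k, m, φ, hm, ⟨ψ⟩⟩)
    -- Alternative (a) is impossible: it makes `P` cyclic.
    · exfalso
      apply h.ne_zpowers
      have hcyc : IsCyclic P := isCyclic_of_surjective f.symm f.symm.surjective
      obtain ⟨⟨g, hg⟩, hgen⟩ := hcyc.exists_generator
      refine ⟨g, le_antisymm (fun x hx => ?_) (Subgroup.zpowers_le.2 hg)⟩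
      obtain ⟨i, hi⟩ := hgen ⟨x, hx⟩
      exact ⟨i, congrArg Subtype.val hi⟩
    · obtain ⟨rfl, ⟨e⟩⟩ := h.quaternion_of_mulEquiv hm ψ
      exact h.irredundantCoverCount_of_quaternion e
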